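/- For $D>0$, call a compact (Hausdorff) topological group $G$ \emph{$D$-quasirandom} if every continuous unitary representation of $G$ of finite dimension less than $D$ is trivial (every group element acts as the identity). Integrals over $G$ and over $G^{k}$ are taken with respect to the normalized Haar measures. For $g\in G$ and $0\le i\le k$ let \[ T_{[1,i]}^{g}(a_{1},\dots,a_{k})=(ga_{1},\dots,ga_{i},a_{i+1},\dots,a_{k}), \] so that $T_{[1,0]}^{g}$ is the identity. \textbf{Theorem.} For every $k\in\mathbb{N}$ there is a function $\delta_{k}$ with $\delta_{k}(D)\to 0$ as $D\to\infty$ such that the following holds. Let $G$ be a compact $D$-quasirandom group, let $f_{0},\dots,f_{k}:G^{k}\to[-1,1]$ be Haar measurable, and let \[ c_{g}=\int_{G^{k}}\prod_{i=0}^{k}f_{i}\bigl(T_{[1,i]}^{g}\vec a\bigr)\,d\vec a ,\qquad g\in G. \] Then all these integrals exist, $g\mapsto c_{g}$ is integrable, and \[ \int_{G}\Bigl|c_{g}-\int_{G}c_{h}\,dh\Bigr|\,dg\le\delta_{k}(D). \] That is, the left-hand side is $o_{D\to\infty;k}(1)$, uniformly over all compact $D$-quasirandom groups $G$ and all such $f_{0},\dots,f_{k}$.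 -/

import Mathlib

open MeasureTheory Filter Topology

/-- A topological group is `D`-quasirandom if every (continuous, finite-dimensional) unitary
representation of dimension less than `D` is trivial. -/
def IsQuasirandom (D : ℝ) (G : Type*) [Group G] [TopologicalSpace G] : Prop :=
  ∀ n : ℕ, (n : ℝ) < D → ∀ ρ : G →* Matrix.unitaryGroup (Fin n) ℂ, Continuous ρ → ∀ g, ρ g = 1

section Haar

variable (H : Type*) [Group H] [TopologicalSpace H] [IsTopologicalGroup H] [CompactSpace H]

/-- The normalized (regular, total mass one) Haar measure of a compact group, on its Borel
`σ`-algebra.  The `σ`-algebra is explicit since, for a group without countable base, the Borel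
`σ`-algebra of `Fin k → H` is larger than the product of the Borel `σ`-algebras. -/
noncomputable def haarProb : @Measure H (borel H) :=
  letI := borel H
  haveI : BorelSpace H := ⟨rfl⟩
  Measure.haarMeasure ⊤

variable {H}

/-- Measurability with respect to (the completion of) Haar measure. -/
def HaarMeasurable (F : H → ℝ) : Prop :=
  letI := borel H
  AEStronglyMeasurable F (haarProb H)

/-- Integrability with respect to Haar measure. -/
def HaarIntegrable (F : H → ℝ) : Prop :=
  letI := borel H
  Integrable F (haarProb H)

/-- The integral with respect to normalized Haar measure. -/
noncomputable def haarIntegral (F : H → ℝ) : ℝ :=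
  letI := borel H
  ∫ x, F x ∂haarProb H

end Haar

/-- The action `T_i` of `G` on `G^k`:
`T_i^g (a_1, …, a_k) = (a_1, …, a_{i-1}, g a_i, a_{i+1}, …, a_k)`. -/
def coordAct {G : Type*} [Group G] {k : ℕ} (i : Fin k) (g : G) (a : Fin k → G) : Fin k → G :=
  Function.update a i (g * a i)

/-- `T_{[1,i]}^g (a_1, …, a_k) = (g a_1, …, g a_i, a_{i+1}, …, a_k)` for `0 ≤ i ≤ k`.
The coordinates `a_1, …, a_k` have the indices `0, …, k - 1`. -/
def prefixAct {G : Type*} [Group G] {k : ℕ} (i : Fin (k + 1)) (g : G) (a : Fin k → G) :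
    Fin k → G :=
  fun j => if j.castSucc < i then g * a j else a j

theorem prefixAct_zero {G : Type*} [Group G] {k : ℕ} (g : G) (a : Fin k → G) :
    prefixAct 0 g a = a := by
  funext j
  simp [prefixAct]

/-- `T_{[1,i+1]} = T_{[1,i]} T_{i+1}`: the closed form above is the composition of the `T_j`. -/
theorem prefixAct_succ {G : Type*} [Group G] {k : ℕ} (i : Fin k) (g : G) (a : Fin k → G) :
    prefixAct i.succ g a = prefixAct i.castSucc g (coordAct i g a) := by
  funext j
  rcases lt_trichotomy j i with h | h | h
  · have h1 : j.castSucc < i.succ := by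
      simp only [Fin.lt_def, Fin.val_castSucc, Fin.val_succ] at *; omega
    simp [prefixAct, coordAct, h, h1, h.ne]
  · subst h
    simp [prefixAct, coordAct]
  · have h1 : ¬ j.castSucc < i.succ := by
      simp only [Fin.lt_def, Fin.val_castSucc, Fin.val_succ] at *; omega
    simp [prefixAct, coordAct, h1, h.not_gt, h.ne']

/-- The function `∏_{i=0}^k f_i T_{[1,i]}^g` on `G^k`. -/
def multicorrIntegrand {G : Type*} [Group G] {k : ℕ} (f : Fin (k + 1) → (Fin k → G) → ℝ)
    (g : G) (a : Fin k → G) : ℝ :=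
  ∏ i : Fin (k + 1), f i (prefixAct i g a)

/-- The multicorrelation sequence `c_g = ∫_{G^k} ∏_{i=0}^k f_i T_{[1,i]}^g`. -/
noncomputable def multicorr {G : Type*} [Group G] [TopologicalSpace G] [IsTopologicalGroup G]
    [CompactSpace G] {k : ℕ} (f : Fin (k + 1) → (Fin k → G) → ℝ) (g : G) : ℝ :=
  haarIntegral (multicorrIntegrand f g)

/-! View `c_g` as the correlation of `f 0` with the translates of the other functions under
commuting-up-to-conjugation actions `σ i` of `G` on `X = G^k` (`prefixHom`), and induct on `k`.
Structured functions are products `∏ φ i` with `φ i` invariant under `σ i` (`invProducts`).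

If `f 0` is structured, each `φ i` can be moved inside the `i`-th translate. Then every factor is
translated by `g` in the first coordinate, invariance of Haar measure removes that translation, and
`c_g` becomes an average, over the first coordinate, of sequences of order `k - 1`
(`actionCorr_eq_haarIntegral_multicorr`).

If `f 0` correlates with no structured function, `c_g` is small in mean square
(`pow_haarIntegral_sq_correlation_le`). Expanding the square and applying Gowers–Cauchy–Schwarz on
`G × X × X` bounds a power of the mean square by the average `boxSq`. Quasirandomness enters here,
apart from the inductive hypothesis: mixing along orbits bounds `boxSq` by `boxInt + 1 / D`
(`boxSq_le_boxInt_add`). Coordinates on `X` then turn the box integral of `f 0` into a correlation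
with a structured function (`exists_boxInt_le`).

An energy increment (`exists_boundedComb_near`) splits a general `f 0` into a combination of
structured functions, of complexity independent of `G` and `D`, and an error of the second kind.

Mixing is spectral (`sq_norm_convOp_le`): eigenspaces of a convolution operator with mean-zero
kernel are translation invariant, so those of nonzero eigenvalue have dimension at least `D`, and
the Hilbert–Schmidt bound makes the operator small. All this is done for continuous functions, where
Fubini needs no product `σ`-algebra; measurable ones follow by `L¹` approximation. -/

/-! ### The Haar integral of continuous functions -/

section HaarIntegral

variable {H : Type*} [Group H] [TopologicalSpace H] [IsTopologicalGroup H] [CompactSpace H]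

theorem haarIntegral_eq_integral [mH : MeasurableSpace H] [bH : BorelSpace H] (F : H → ℝ) :
    haarIntegral F = ∫ x, F x ∂(Measure.haarMeasure (⊤ : TopologicalSpace.PositiveCompacts H)) := by
  obtain rfl := bH.measurable_eq
  rfl

theorem haarIntegrable_iff_integrable [mH : MeasurableSpace H] [bH : BorelSpace H] (F : H → ℝ) :
    HaarIntegrable F ↔
      Integrable F (Measure.haarMeasure (⊤ : TopologicalSpace.PositiveCompacts H)) := by
  obtain rfl := bH.measurable_eq
  rfl

instance isProbabilityMeasure_haarMeasure_top [MeasurableSpace H] [BorelSpace H] :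
    IsProbabilityMeasure (Measure.haarMeasure (⊤ : TopologicalSpace.PositiveCompacts H)) :=
  ⟨by simpa using Measure.haarMeasure_self (G := H) (K₀ := ⊤)⟩

theorem Continuous.integrable_of_compactSpace {X : Type*} [TopologicalSpace X] [CompactSpace X]
    [MeasurableSpace X] [OpensMeasurableSpace X] {μ : Measure X} [IsFiniteMeasure μ]
    {E : Type*} [NormedAddCommGroup E] [SecondCountableTopologyEither X E]
    {F : X → E} (hF : Continuous F) : Integrable F μ :=
  hF.integrable_of_hasCompactSupport (HasCompactSupport.of_compactSpace F)

theorem Continuous.haarIntegrable {F : H → ℝ} (hF : Continuous F) : HaarIntegrable F := by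
  borelize H
  exact (haarIntegrable_iff_integrable F).2 hF.integrable_of_compactSpace

@[simp]
theorem haarIntegral_const (c : ℝ) : haarIntegral (fun _ : H => c) = c := by
  borelize H
  simp [haarIntegral_eq_integral]

theorem haarIntegral_add {F F' : H → ℝ} (hF : Continuous F) (hF' : Continuous F') :
    haarIntegral (fun x => F x + F' x) = haarIntegral F + haarIntegral F' := by
  borelize H
  simp only [haarIntegral_eq_integral]
  exact integral_add hF.integrable_of_compactSpace hF'.integrable_of_compactSpace

theorem haarIntegral_sub {F F' : H → ℝ} (hF : Continuous F) (hF' : Continuous F') :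
    haarIntegral (fun x => F x - F' x) = haarIntegral F - haarIntegral F' := by
  borelize H
  simp only [haarIntegral_eq_integral]
  exact integral_sub hF.integrable_of_compactSpace hF'.integrable_of_compactSpace

theorem haarIntegral_const_mul (c : ℝ) (F : H → ℝ) :
    haarIntegral (fun x => c * F x) = c * haarIntegral F := by
  borelize H
  simp only [haarIntegral_eq_integral]
  exact integral_const_mul c F

theorem haarIntegral_mul_const (c : ℝ) (F : H → ℝ) :
    haarIntegral (fun x => F x * c) = haarIntegral F * c := by
  borelize H
  simp only [haarIntegral_eq_integral]
  exact integral_mul_const c F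

theorem haarIntegral_mono {F F' : H → ℝ} (hF : Continuous F) (hF' : Continuous F')
    (h : ∀ x, F x ≤ F' x) : haarIntegral F ≤ haarIntegral F' := by
  borelize H
  simp only [haarIntegral_eq_integral]
  exact integral_mono hF.integrable_of_compactSpace hF'.integrable_of_compactSpace h

theorem haarIntegral_nonneg {F : H → ℝ} (h : ∀ x, 0 ≤ F x) : 0 ≤ haarIntegral F := by
  borelize H
  rw [haarIntegral_eq_integral]
  exact integral_nonneg h

theorem abs_haarIntegral_le (F : H → ℝ) :
    |haarIntegral F| ≤ haarIntegral (fun x => |F x|) := by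
  borelize H
  simp only [haarIntegral_eq_integral]
  exact abs_integral_le_integral_abs

theorem haarIntegral_le_of_le {F : H → ℝ} (hF : Continuous F) {c : ℝ} (h : ∀ x, F x ≤ c) :
    haarIntegral F ≤ c := by
  simpa using haarIntegral_mono hF continuous_const h

theorem abs_haarIntegral_le_of_le {F : H → ℝ} (hF : Continuous F) {c : ℝ} (h : ∀ x, |F x| ≤ c) :
    |haarIntegral F| ≤ c :=
  (abs_haarIntegral_le F).trans (haarIntegral_le_of_le hF.abs h)

theorem exists_haarIntegral_le {F : H → ℝ} (hF : Continuous F) : ∃ x, haarIntegral F ≤ F x := by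
  obtain ⟨x, -, hx⟩ := isCompact_univ.exists_isMaxOn (Set.univ_nonempty (α := H)) hF.continuousOn
  exact ⟨x, haarIntegral_le_of_le hF fun y => hx (Set.mem_univ y)⟩

theorem haarIntegral_mul_left (F : H → ℝ) (h : H) :
    haarIntegral (fun x => F (h * x)) = haarIntegral F := by
  borelize H
  simp only [haarIntegral_eq_integral]
  exact integral_mul_left_eq_self F h

/-- Currying gives a continuous map into `C(H, ℝ)`, on which the integral is 1-Lipschitz for the sup
norm; hence no countability is needed of `X`. -/
theorem Continuous.haarIntegral_left {X : Type*} [TopologicalSpace X] {F : X → H → ℝ}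
    (hF : Continuous fun p : X × H => F p.1 p.2) : Continuous fun x => haarIntegral (F x) := by
  let c : C(X, C(H, ℝ)) := (ContinuousMap.mk _ hF).curry
  have h : Continuous fun φ : C(H, ℝ) => haarIntegral φ := by
    refine continuous_iff_continuousAt.2 fun φ => tendsto_iff_dist_tendsto_zero.2 ?_
    refine squeeze_zero (fun _ => dist_nonneg) (fun ψ => ?_)
      (tendsto_iff_dist_tendsto_zero.1 (tendsto_id (x := 𝓝 φ)))
    rw [Real.dist_eq, ← haarIntegral_sub ψ.continuous φ.continuous]
    refine abs_haarIntegral_le_of_le (by fun_prop) fun x => ?_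
    exact (Real.dist_eq _ _).symm.trans_le (ContinuousMap.dist_apply_le_dist x)
  exact h.comp c.continuous

theorem haarIntegral_swap {K : Type*} [Group K] [TopologicalSpace K] [IsTopologicalGroup K]
    [CompactSpace K] {F : H → K → ℝ} (hF : Continuous fun p : H × K => F p.1 p.2) :
    haarIntegral (fun x => haarIntegral (F x)) =
      haarIntegral (fun y => haarIntegral fun x => F x y) := by
  borelize H
  borelize K
  simp only [haarIntegral_eq_integral]
  exact integral_integral_swap_of_hasCompactSupport hF (HasCompactSupport.of_compactSpace _)

/-- Unimodularity of compact groups, by averaging `F (x⁻¹ * y)` over both variables in either order.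
-/
theorem haarIntegral_inv {F : H → ℝ} (hF : Continuous F) :
    haarIntegral (fun x => F x⁻¹) = haarIntegral F := by
  calc haarIntegral (fun x => F x⁻¹)
      = haarIntegral (fun y : H => haarIntegral fun x => F (y⁻¹ * x)⁻¹) := by
        rw [← haarIntegral_const (H := H) (haarIntegral fun x => F x⁻¹)]
        congr 1; funext y
        exact (haarIntegral_mul_left (fun x => F x⁻¹) y⁻¹).symm
    _ = haarIntegral (fun x : H => haarIntegral fun y => F (x⁻¹ * y)) := by
        rw [haarIntegral_swap (by fun_prop)]
        simp
    _ = haarIntegral F := by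
        simp only [haarIntegral_mul_left, haarIntegral_const]

theorem haarIntegral_mul_right {F : H → ℝ} (hF : Continuous F) (h : H) :
    haarIntegral (fun x => F (x * h)) = haarIntegral F := by
  rw [← haarIntegral_inv (F := fun x => F (x * h)) (by fun_prop), ← haarIntegral_inv hF,
    ← haarIntegral_mul_left (fun x => F x⁻¹) h⁻¹]
  simp

/-- Cauchy–Schwarz for two continuous functions. -/
theorem haarIntegral_mul_sq_le {F F' : H → ℝ} (hF : Continuous F) (hF' : Continuous F') :
    haarIntegral (fun x => F x * F' x) ^ 2 ≤
      haarIntegral (fun x => F x ^ 2) * haarIntegral (fun x => F' x ^ 2) := by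
  have key (t : ℝ) : 0 ≤ haarIntegral (fun x => F' x ^ 2) * (t * t) +
      (-(2 * haarIntegral (fun x => F x * F' x))) * t + haarIntegral (fun x => F x ^ 2) := by
    have h : haarIntegral (fun x => (F x - t * F' x) ^ 2) =
        haarIntegral (fun x => F' x ^ 2) * (t * t) +
          (-(2 * haarIntegral (fun x => F x * F' x))) * t + haarIntegral (fun x => F x ^ 2) := by
      have h1 : (fun x => (F x - t * F' x) ^ 2) =
          fun x => (t * t * F' x ^ 2 + (-(2 * t)) * (F x * F' x)) + F x ^ 2 := by
        funext x; ring
      rw [h1, haarIntegral_add (by fun_prop) (by fun_prop),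
        haarIntegral_add (by fun_prop) (by fun_prop), haarIntegral_const_mul,
        haarIntegral_const_mul]
      ring
    rw [← h]
    exact haarIntegral_nonneg fun x => sq_nonneg _
  have := discrim_le_zero key
  unfold discrim at this
  nlinarith

theorem sq_haarIntegral_le {F : H → ℝ} (hF : Continuous F) :
    haarIntegral F ^ 2 ≤ haarIntegral (fun x => F x ^ 2) := by
  simpa using haarIntegral_mul_sq_le hF (continuous_const (y := (1 : ℝ)))

theorem haarIntegral_pow_two_pow_le {F : H → ℝ} (hF : Continuous F) (n : ℕ) :
    haarIntegral F ^ 2 ^ n ≤ haarIntegral (fun x => F x ^ 2 ^ n) := by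
  induction n with
  | zero => simp
  | succ n ih =>
    -- Squaring the inductive inequality needs a nonnegative left side, which evenness of `2 ^ n`
    -- gives only for `n > 0`.
    rcases Nat.eq_zero_or_pos n with rfl | hn
    · simpa using sq_haarIntegral_le hF
    · have h0 : 0 ≤ haarIntegral F ^ 2 ^ n :=
        Even.pow_nonneg ((Nat.even_pow).2 ⟨even_two, hn.ne'⟩) _
      simp only [pow_succ 2 n, pow_mul]
      exact (pow_le_pow_left₀ h0 ih 2).trans (sq_haarIntegral_le (by fun_prop))

/-- A translation invariant averaging functional which can be interchanged with the Haar integral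
is the Haar integral. -/
theorem eq_haarIntegral_of_invariant {F : H → ℝ} (hF : Continuous F) (J : (H → ℝ) → ℝ)
    (hconst : ∀ c, J (fun _ => c) = c) (hinv : ∀ y, J (fun x => F (y * x)) = J F)
    (hswap : haarIntegral (fun y => J fun x => F (y * x)) =
      J fun x => haarIntegral fun y => F (y * x)) : J F = haarIntegral F := by
  simp only [hinv, haarIntegral_mul_right hF, haarIntegral_const, hconst] at hswap
  exact hswap

/-- Haar measure on the product may live on more than the product `σ`-algebra, so this rests on
uniqueness of the invariant average instead of on product measures. -/
theorem haarIntegral_prod {K : Type*} [Group K] [TopologicalSpace K] [IsTopologicalGroup K]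
    [CompactSpace K] {F : H × K → ℝ} (hF : Continuous F) :
    haarIntegral F = haarIntegral fun x => haarIntegral fun y => F (x, y) := by
  refine (eq_haarIntegral_of_invariant hF
    (fun F => haarIntegral fun x => haarIntegral fun y => F (x, y)) (by simp) ?_ ?_).symm
  · rintro ⟨a, b⟩
    simp only [Prod.mk_mul_mk]
    rw [haarIntegral_mul_left fun x => haarIntegral fun y => F (x, b * y)]
    congr 1; funext x
    exact haarIntegral_mul_left (fun y => F (x, y)) b
  · simp only
    rw [haarIntegral_swap (Continuous.haarIntegral_left (by fun_prop))]
    congr 1; funext x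
    exact haarIntegral_swap (by fun_prop)

theorem haarIntegral_unique [Subsingleton H] (F : H → ℝ) : haarIntegral F = F 1 := by
  rw [← haarIntegral_const (H := H) (F 1)]
  congr 1; funext x
  rw [Subsingleton.elim x 1]

theorem haarIntegral_fin_cons {k : ℕ} {F : (Fin (k + 1) → H) → ℝ} (hF : Continuous F) :
    haarIntegral F =
      haarIntegral fun x : H => haarIntegral fun y : Fin k → H => F (Fin.cons x y) := by
  have hc : Continuous fun p : H × (Fin k → H) => (Fin.cons p.1 p.2 : Fin (k + 1) → H) :=
    Continuous.finCons (A := fun _ => H) continuous_fst continuous_snd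
  have hmul (a : Fin (k + 1) → H) (x : H) (y : Fin k → H) :
      a * (Fin.cons x y : Fin (k + 1) → H) = Fin.cons (a 0 * x) (Fin.tail a * y) := by
    funext j
    refine Fin.cases ?_ (fun j => ?_) j <;> simp [Fin.tail]
  refine (eq_haarIntegral_of_invariant hF
    (fun F => haarIntegral fun x : H => haarIntegral fun y : Fin k → H => F (Fin.cons x y))
    (by simp) ?_ ?_).symm
  · intro a
    simp only [hmul]
    rw [haarIntegral_mul_left
      fun x => haarIntegral fun y : Fin k → H => F (Fin.cons x (Fin.tail a * y))]
    congr 1; funext x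
    exact haarIntegral_mul_left (fun y => F (Fin.cons x y)) _
  · simp only
    rw [haarIntegral_swap (Continuous.haarIntegral_left
      (hF.comp (by fun_prop : Continuous fun p : ((Fin (k + 1) → H) × H) × (Fin k → H) =>
        p.1.1 * (Fin.cons p.1.2 p.2 : Fin (k + 1) → H))))]
    congr 1; funext x
    refine haarIntegral_swap (hF.comp ?_)
    fun_prop

end HaarIntegral

/-! ### Quasirandom groups have no nontrivial small unitary representations -/

/-- A finite dimensional isometric, weakly continuous representation of dimension less than `D`
of a `D`-quasirandom group is trivial. -/
theorem IsQuasirandom.eq_one_of_finrank_lt {D : ℝ} {G : Type*} [Group G] [TopologicalSpace G]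
    (hG : IsQuasirandom D G) {V : Type*} [NormedAddCommGroup V] [InnerProductSpace ℂ V]
    [FiniteDimensional ℂ V] (r : G →* (V →ₗ[ℂ] V))
    (hr : ∀ g v w, inner ℂ (r g v) (r g w) = inner ℂ v w)
    (hc : ∀ v w, Continuous fun g => inner ℂ v (r g w))
    (hd : (Module.finrank ℂ V : ℝ) < D) (g : G) : r g = 1 := by
  let b := stdOrthonormalBasis ℂ V
  let M := LinearMap.toMatrixOrthonormal b
  have hU (g : G) : M (r g) ∈ Matrix.unitaryGroup (Fin (Module.finrank ℂ V)) ℂ := by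
    rw [Matrix.mem_unitaryGroup_iff']
    ext i j
    simp only [M, Matrix.mul_apply, Matrix.star_apply, LinearMap.toMatrixOrthonormal_apply_apply,
      RCLike.star_def, inner_conj_symm]
    rw [b.sum_inner_mul_inner, hr, b.inner_eq_ite, Matrix.one_apply]
  let ρ : G →* Matrix.unitaryGroup (Fin (Module.finrank ℂ V)) ℂ :=
    { toFun := fun g => ⟨M (r g), hU g⟩
      map_one' := by ext1; simp
      map_mul' := fun g h => by ext1; simp }
  have hρ : Continuous ρ := by
    refine Continuous.subtype_mk (continuous_matrix fun i j => ?_) _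
    simpa only [M, LinearMap.toMatrixOrthonormal_apply_apply] using hc (b i) (b j)
  have h1 : M (r g) = 1 := congrArg Subtype.val (hG _ hd ρ hρ g)
  exact M.injective (h1.trans (map_one M).symm)

/-! ### Integral operators with a continuous kernel -/

section Kernel

variable {X E : Type*} [TopologicalSpace X] [CompactSpace X] [NormedAddCommGroup E]
  [InnerProductSpace ℂ E]

/-- The operator `ξ ↦ (x ↦ ⟪κ x, ξ⟫)` defined by a continuous family `κ` of vectors. -/
noncomputable def kernelMap (κ : C(X, E)) : E →L[ℂ] BoundedContinuousFunction X ℂ :=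
  LinearMap.mkContinuous
    { toFun := fun ξ => BoundedContinuousFunction.mkOfCompact
        ⟨fun x => inner ℂ (κ x) ξ, by fun_prop⟩
      map_add' := fun ξ η => by ext x; simp
      map_smul' := fun c ξ => by ext x; simp }
    ‖κ‖ fun ξ => by
      refine (BoundedContinuousFunction.norm_le (by positivity)).2 fun x => ?_
      exact (norm_inner_le_norm _ _).trans
        (mul_le_mul_of_nonneg_right (κ.norm_coe_le_norm x) (norm_nonneg _))

@[simp]
theorem kernelMap_apply (κ : C(X, E)) (ξ : E) (x : X) : kernelMap κ ξ x = inner ℂ (κ x) ξ := rfl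

/-- Arzelà–Ascoli: on the unit ball the images are bounded by `‖κ‖` and inherit equicontinuity from
the continuity of `κ`. -/
theorem isCompactOperator_kernelMap (κ : C(X, E)) : IsCompactOperator (kernelMap κ) := by
  refine (isCompactOperator_iff_isCompact_closure_image_closedBall
    (kernelMap κ : E →ₗ[ℂ] BoundedContinuousFunction X ℂ) one_pos).2 ?_
  refine BoundedContinuousFunction.arzela_ascoli (Metric.closedBall 0 ‖κ‖)
    (isCompact_closedBall _ _) _ ?_ ?_
  · rintro _ x ⟨ξ, hξ, rfl⟩
    have hξ' : ‖ξ‖ ≤ 1 := by simpa using hξ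
    have := (norm_inner_le_norm (𝕜 := ℂ) (κ x) ξ).trans
      (mul_le_mul (κ.norm_coe_le_norm x) hξ' (norm_nonneg _) (norm_nonneg _))
    simpa using this
  · refine fun x₀ => Metric.equicontinuousAt_iff_right.2 fun ε hε => ?_
    have hx := Metric.tendsto_nhds.1 (κ.continuous.tendsto x₀) ε hε
    filter_upwards [hx] with x hx
    rintro ⟨_, ξ, hξ, rfl⟩
    have hξ' : ‖ξ‖ ≤ 1 := by simpa using hξ
    simp only [ContinuousLinearMap.coe_coe, kernelMap_apply]
    rw [dist_eq_norm, ← inner_sub_left]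
    calc ‖inner ℂ (κ x₀ - κ x) ξ‖ ≤ ‖κ x₀ - κ x‖ * ‖ξ‖ := norm_inner_le_norm _ _
      _ ≤ ‖κ x₀ - κ x‖ * 1 := mul_le_mul_of_nonneg_left hξ' (norm_nonneg _)
      _ < ε := by rwa [mul_one, ← dist_eq_norm, dist_comm]

end Kernel

/-- The norm of a self-adjoint operator is its spectral radius, and the nonzero spectrum of a
compact operator consists of eigenvalues. -/
theorem ContinuousLinearMap.norm_le_of_hasEigenvalue {E : Type*} [NormedAddCommGroup E]
    [InnerProductSpace ℂ E] [CompleteSpace E] {T : E →L[ℂ] E} (hT : IsCompactOperator T)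
    (hs : (T : E →ₗ[ℂ] E).IsSymmetric) {B : ℝ} (hB : 0 ≤ B)
    (h : ∀ z : ℂ, z ≠ 0 → Module.End.HasEigenvalue (T : Module.End ℂ E) z → ‖z‖ ≤ B) :
    ‖T‖ ≤ B := by
  have h1 : spectralRadius ℂ T ≤ (B.toNNReal : ENNReal) := by
    refine iSup₂_le fun z hz => ?_
    rw [ENNReal.coe_le_coe]
    rcases eq_or_ne z 0 with rfl | hz0
    · simp
    · rw [← NNReal.coe_le_coe, Real.coe_toNNReal B hB]
      exact h z hz0 ((hT.hasEigenvalue_iff_mem_spectrum hz0).2 hz)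
  rw [T.spectralRadius_eq_nnnorm (ContinuousLinearMap.isSelfAdjoint_iff_isSymmetric.2 hs),
    ENNReal.coe_le_coe, ← NNReal.coe_le_coe, Real.coe_toNNReal B hB] at h1
  exact h1

/-! ### Translations and convolution operators on `L²` -/

section Convolution

variable {G : Type*} [Group G] [TopologicalSpace G] [IsTopologicalGroup G] [CompactSpace G]
  [MeasurableSpace G] [BorelSpace G]

/-- The normalized Haar measure, for a given Borel structure. -/
local notation "μH" => (Measure.haarMeasure (⊤ : TopologicalSpace.PositiveCompacts G))

theorem norm_sq_toLp {X : Type*} [TopologicalSpace X] [MeasurableSpace X] [BorelSpace X]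
    (μ : Measure X) [IsFiniteMeasure μ] (f : BoundedContinuousFunction X ℂ) :
    ‖BoundedContinuousFunction.toLp 2 μ ℂ f‖ ^ 2 = ∫ x, ‖f x‖ ^ 2 ∂μ := by
  have h := BoundedContinuousFunction.inner_toLp μ f f
  rw [inner_self_eq_norm_sq_to_K] at h
  have h2 : ∫ x, f x * (starRingEnd ℂ) (f x) ∂μ = ((∫ x, ‖f x‖ ^ 2 ∂μ : ℝ) : ℂ) := by
    rw [← integral_complex_ofReal]
    congr 1; funext x
    rw [RCLike.mul_conj]
    norm_cast
  rw [h2] at h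
  exact Complex.ofReal_injective (by simpa using h)

/-- Translation `ξ ↦ ξ (g * ·)` on `L²`. -/
noncomputable def translateLp (g : G) : Lp ℂ 2 μH →ₗᵢ[ℂ] Lp ℂ 2 μH where
  toFun ξ := DomMulAct.mk g • ξ
  map_add' _ _ := smul_add _ _ _
  map_smul' _ _ := smul_comm _ _ _
  norm_map' _ := DomMulAct.norm_smul_Lp _ _

theorem translateLp_apply (g : G) (ξ : Lp ℂ 2 μH) : translateLp g ξ = DomMulAct.mk g • ξ := rfl

theorem translateLp_mul (g h : G) (ξ : Lp ℂ 2 μH) :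
    translateLp (g * h) ξ = translateLp h (translateLp g ξ) := by
  simp only [translateLp_apply, DomMulAct.mk_mul, mul_smul]

theorem translateLp_one (ξ : Lp ℂ 2 μH) : translateLp 1 ξ = ξ := by
  simp only [translateLp_apply, DomMulAct.mk_one, one_smul]

theorem continuous_translateLp (ξ : Lp ℂ 2 μH) : Continuous fun g : G => translateLp g ξ := by
  have : Fact ((2 : ENNReal) ≠ ⊤) := ⟨by simp⟩
  have : Continuous fun g : G => (DomMulAct.mk g : Gᵈᵐᵃ) := DomMulAct.continuous_mk
  exact this.smul continuous_const

theorem translateLp_toLp (g : G) (f f' : BoundedContinuousFunction G ℂ)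
    (h : ∀ x, f' x = f (g * x)) :
    translateLp g (BoundedContinuousFunction.toLp 2 μH ℂ f) =
      BoundedContinuousFunction.toLp 2 μH ℂ f' := by
  rw [translateLp_apply]
  refine Lp.ext ?_
  have h1 := DomMulAct.smul_Lp_ae_eq (DomMulAct.mk g) (BoundedContinuousFunction.toLp 2 μH ℂ f)
  have h2 := BoundedContinuousFunction.coeFn_toLp 2 μH ℂ f
  have h3 := BoundedContinuousFunction.coeFn_toLp 2 μH ℂ f'
  have h4 := (measurePreserving_smul g μH).quasiMeasurePreserving.ae_eq_comp h2
  filter_upwards [h1, h3, h4] with x h1 h3 h4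
  rw [h1, h3, h x]
  exact h4

/-- The kernel `x ↦ ψ (x⁻¹ * ·)`. -/
noncomputable def convKernel (ψ : C(G, ℝ)) : C(G, Lp ℂ 2 μH) :=
  ⟨fun x => ContinuousMap.toLp 2 μH ℂ
    ((ContinuousMap.mk (fun p : G × G => (ψ (p.1⁻¹ * p.2) : ℂ)) (by fun_prop)).curry x), by
    fun_prop⟩

theorem convKernel_apply (ψ : C(G, ℝ)) (x : G) :
    convKernel ψ x = BoundedContinuousFunction.toLp 2 μH ℂ (BoundedContinuousFunction.mkOfCompact
      ⟨fun y => (ψ (x⁻¹ * y) : ℂ), by fun_prop⟩) := rfl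

theorem translateLp_convKernel (ψ : C(G, ℝ)) (g x : G) :
    translateLp g (convKernel ψ (g * x)) = convKernel ψ x := by
  rw [convKernel_apply, convKernel_apply]
  exact translateLp_toLp _ _ _ fun y => by simp [mul_assoc]

/-- The convolution operator `ξ ↦ (x ↦ ∫ ψ (x⁻¹ * y) ξ(y) dy)` on `L²`. -/
noncomputable def convOp (ψ : C(G, ℝ)) : Lp ℂ 2 μH →L[ℂ] Lp ℂ 2 μH :=
  (BoundedContinuousFunction.toLp 2 μH ℂ).comp (kernelMap (convKernel ψ))

theorem convOp_apply (ψ : C(G, ℝ)) (ξ : Lp ℂ 2 μH) :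
    convOp ψ ξ = BoundedContinuousFunction.toLp 2 μH ℂ (kernelMap (convKernel ψ) ξ) := rfl

theorem isCompactOperator_convOp (ψ : C(G, ℝ)) : IsCompactOperator (convOp ψ) :=
  (isCompactOperator_kernelMap _).clm_comp (BoundedContinuousFunction.toLp 2 μH ℂ)

theorem kernelMap_convKernel_translateLp (ψ : C(G, ℝ)) (g x : G) (ξ : Lp ℂ 2 μH) :
    kernelMap (convKernel ψ) (translateLp g ξ) x = kernelMap (convKernel ψ) ξ (g * x) := by
  rw [kernelMap_apply, kernelMap_apply, ← translateLp_convKernel ψ g x,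
    LinearIsometry.inner_map_map]

theorem convOp_translateLp (ψ : C(G, ℝ)) (g : G) (ξ : Lp ℂ 2 μH) :
    convOp ψ (translateLp g ξ) = translateLp g (convOp ψ ξ) :=
  (translateLp_toLp g _ _ fun x => kernelMap_convKernel_translateLp ψ g x ξ).symm

theorem kernelMap_convKernel_toLp (ψ : C(G, ℝ)) (f : BoundedContinuousFunction G ℂ) (x : G) :
    kernelMap (convKernel ψ) (BoundedContinuousFunction.toLp 2 μH ℂ f) x =
      ∫ y, ψ (x⁻¹ * y) * f y ∂μH := by
  rw [kernelMap_apply, convKernel_apply, BoundedContinuousFunction.inner_toLp]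
  simp [mul_comm]

theorem inner_convOp_toLp (ψ : C(G, ℝ)) (f f' : BoundedContinuousFunction G ℂ) :
    inner ℂ (BoundedContinuousFunction.toLp 2 μH ℂ f')
      (convOp ψ (BoundedContinuousFunction.toLp 2 μH ℂ f)) =
      ∫ x, ∫ y, ψ (x⁻¹ * y) * f y * (starRingEnd ℂ) (f' x) ∂μH ∂μH := by
  rw [convOp_apply, BoundedContinuousFunction.inner_toLp]
  simp only [kernelMap_convKernel_toLp, integral_mul_const]

/-- By density it suffices to test on continuous functions, where Fubini and the symmetry of the
kernel `ψ (x⁻¹ * y)` give the claim. -/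
theorem isSymmetric_convOp [T2Space G] (ψ : C(G, ℝ)) (hψ : ∀ x, ψ x⁻¹ = ψ x) :
    (convOp ψ : Lp ℂ 2 μH →ₗ[ℂ] Lp ℂ 2 μH).IsSymmetric := by
  have hd := ContinuousMap.toLp_denseRange ℂ μH ℂ (p := 2) (by simp)
  refine fun ξ η => hd.induction_on₂ (p := fun ξ η => inner ℂ (convOp ψ ξ) η =
    inner ℂ ξ (convOp ψ η)) ?_ (fun f f' => ?_) ξ η
  · exact isClosed_eq (by fun_prop) (by fun_prop)
  · have h (f : C(G, ℂ)) : ContinuousMap.toLp 2 μH ℂ f = BoundedContinuousFunction.toLp 2 μH ℂ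
      (BoundedContinuousFunction.mkOfCompact f) := rfl
    rw [h, h, inner_convOp_toLp, ← inner_conj_symm, inner_convOp_toLp,
      integral_integral_swap_of_hasCompactSupport _ (HasCompactSupport.of_compactSpace _)]
    · simp only [← integral_conj]
      congr 1; funext x; congr 1; funext y
      simp only [map_mul, Complex.conj_ofReal, Complex.conj_conj,
        BoundedContinuousFunction.mkOfCompact_apply]
      rw [← hψ (x⁻¹ * y)]
      simp only [mul_inv_rev, inv_inv]
      ring
    · simp only [Function.uncurry_def, BoundedContinuousFunction.mkOfCompact_apply]
      fun_prop

theorem norm_sq_convKernel (ψ : C(G, ℝ)) (x : G) :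
    ‖convKernel ψ x‖ ^ 2 = ∫ y, ψ y ^ 2 ∂μH := by
  rw [convKernel_apply, norm_sq_toLp, ← integral_mul_left_eq_self (fun y => ψ y ^ 2) x⁻¹]
  simp

/-- The Hilbert–Schmidt bound: Bessel's inequality for the vector `convKernel ψ x`, whose norm does
not depend on `x`, integrated over `x`. -/
theorem sum_integral_sq_norm_kernelMap_le (ψ : C(G, ℝ)) {ι : Type*} [Fintype ι]
    (v : ι → Lp ℂ 2 μH) (hv : Orthonormal ℂ v) :
    ∑ i, ∫ x, ‖kernelMap (convKernel ψ) (v i) x‖ ^ 2 ∂μH ≤ ∫ y, ψ y ^ 2 ∂μH := by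
  have hc (i : ι) : Continuous fun x => ‖kernelMap (convKernel ψ) (v i) x‖ ^ 2 :=
    (kernelMap (convKernel ψ) (v i)).continuous.norm.pow 2
  rw [← integral_finsetSum _ fun i _ => (hc i).integrable_of_compactSpace]
  have h := integral_mono (μ := μH)
    (continuous_finsetSum Finset.univ fun i _ => hc i).integrable_of_compactSpace
    (integrable_const (∫ y, ψ y ^ 2 ∂μH)) fun x => ?_
  · simpa using h
  · have h := hv.sum_inner_products_le (convKernel ψ x) (s := Finset.univ)
    rw [norm_sq_convKernel] at h
    simp only [kernelMap_apply]
    refine le_trans (le_of_eq (Finset.sum_congr rfl fun i _ => ?_)) h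
    rw [norm_inner_symm]

/-- The eigenspace is a representation of `G` by translations. In dimension less than `D` it would
consist of invariant functions, which a mean-zero kernel kills; so its dimension is at least `D`,
and the Hilbert–Schmidt bound counts `‖z‖ ^ 2` that many times. -/
theorem sq_norm_eigenvalue_convOp_le [T2Space G] {D : ℝ} (hG : IsQuasirandom D G) (ψ : C(G, ℝ))
    (hψ₀ : ∫ x, ψ x ∂μH = 0) {z : ℂ} (hz : z ≠ 0)
    (hev : Module.End.HasEigenvalue (convOp ψ : Module.End ℂ (Lp ℂ 2 μH)) z) :
    ‖z‖ ^ 2 * D ≤ ∫ y, ψ y ^ 2 ∂μH := by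
  set V := Module.End.eigenspace (convOp ψ : Module.End ℂ (Lp ℂ 2 μH)) z with hV
  have hmem (ξ : Lp ℂ 2 μH) : ξ ∈ V ↔ convOp ψ ξ = z • ξ := Module.End.mem_eigenspace_iff
  have hfin : FiniteDimensional ℂ V :=
    ContinuousLinearMap.finite_dimensional_eigenspace (isCompactOperator_convOp ψ) z hz
  have hinv (g : G) : ∀ ξ ∈ V, (translateLp g).toLinearMap ξ ∈ V := fun ξ hξ => by
    rw [hmem] at hξ ⊢
    simp only [LinearIsometry.coe_toLinearMap]
    rw [convOp_translateLp, hξ, map_smul]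
  -- The inverse is there because `g ↦ translateLp g` reverses products.
  let r : G →* (V →ₗ[ℂ] V) :=
    { toFun := fun g => (translateLp g⁻¹).toLinearMap.restrict (hinv g⁻¹)
      map_one' := by
        ext1 ξ
        exact Subtype.ext (by simpa using translateLp_one (ξ : Lp ℂ 2 μH))
      map_mul' := fun g h => by
        ext1 ξ
        refine Subtype.ext ?_
        simpa using translateLp_mul h⁻¹ g⁻¹ (ξ : Lp ℂ 2 μH) }
  have hr_apply (g : G) (ξ : V) : (r g ξ : Lp ℂ 2 μH) = translateLp g⁻¹ (ξ : Lp ℂ 2 μH) := rfl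
  rcases lt_or_ge (Module.finrank ℂ V : ℝ) D with hd | hd
  · exfalso
    have htriv := hG.eq_one_of_finrank_lt r
      (fun g v w => by
        simp only [Submodule.coe_inner, hr_apply, LinearIsometry.inner_map_map])
      (fun v w => by
        simp only [Submodule.coe_inner, hr_apply]
        exact continuous_const.inner
          ((continuous_translateLp (w : Lp ℂ 2 μH)).comp continuous_inv)) hd
    obtain ⟨ξ, hξV, hξ0⟩ := hev.exists_hasEigenvector
    have hfix (g : G) : translateLp g ξ = ξ := by
      have := congrArg Subtype.val (LinearMap.congr_fun (htriv g⁻¹) ⟨ξ, hξV⟩)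
      simpa [hr_apply] using this
    -- The class `ξ` itself is not shown to be constant: its image is a genuine continuous function,
    -- visibly constant, so the square of the operator kills `ξ` while multiplying it by `z ^ 2`.
    set c := kernelMap (convKernel ψ) ξ 1 with hc
    have hconst : kernelMap (convKernel ψ) ξ = BoundedContinuousFunction.const G c := by
      ext x
      rw [BoundedContinuousFunction.const_apply, hc]
      conv_rhs => rw [← hfix x]
      rw [kernelMap_convKernel_translateLp, mul_one]
    have h1 : convOp ψ ξ =
        BoundedContinuousFunction.toLp 2 μH ℂ (BoundedContinuousFunction.const G c) := by
      rw [convOp_apply, hconst]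
    have h2 : convOp ψ (convOp ψ ξ) = 0 := by
      rw [h1, convOp_apply]
      refine (congrArg _ (?_ : _ = (0 : BoundedContinuousFunction G ℂ))).trans (map_zero _)
      ext x
      rw [kernelMap_convKernel_toLp]
      simp only [BoundedContinuousFunction.const_apply, BoundedContinuousFunction.coe_zero,
        Pi.zero_apply]
      rw [integral_mul_const, integral_complex_ofReal,
        integral_mul_left_eq_self (fun y => ψ y) x⁻¹, hψ₀]
      simp
    rw [(hmem ξ).1 hξV, map_smul, (hmem ξ).1 hξV] at h2
    simp [hz, hξ0] at h2
  · refine le_trans (mul_le_mul_of_nonneg_left hd (sq_nonneg _)) ?_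
    let b := stdOrthonormalBasis ℂ V
    have hb : Orthonormal ℂ fun i => (b i : Lp ℂ 2 μH) := 
      ⟨fun i => b.orthonormal.1 i, fun i j hij => b.orthonormal.2 hij⟩
    have hbi (i : Fin (Module.finrank ℂ V)) :
        ‖z‖ ^ 2 = ∫ x, ‖kernelMap (convKernel ψ) (b i : Lp ℂ 2 μH) x‖ ^ 2 ∂μH := by
      rw [← norm_sq_toLp, ← convOp_apply, (hmem _).1 (b i).2, norm_smul, mul_pow]
      have : ‖(b i : Lp ℂ 2 μH)‖ = 1 := hb.1 i
      rw [this]; simp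
    refine le_trans (le_of_eq ?_) (sum_integral_sq_norm_kernelMap_le ψ _ hb)
    rw [← Finset.sum_congr rfl fun i _ => hbi i]
    simp [mul_comm]

theorem sq_norm_convOp_le [T2Space G] {D : ℝ} (hD : 0 < D) (hG : IsQuasirandom D G) (ψ : C(G, ℝ))
    (hψ : ∀ x, ψ x⁻¹ = ψ x) (hψ₀ : ∫ x, ψ x ∂μH = 0) :
    ‖convOp ψ‖ ^ 2 * D ≤ ∫ y, ψ y ^ 2 ∂μH := by
  have h0 : 0 ≤ ∫ y, ψ y ^ 2 ∂μH := integral_nonneg fun y => sq_nonneg _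
  have h : ‖convOp ψ‖ ≤ √((∫ y, ψ y ^ 2 ∂μH) / D) := by
    refine ContinuousLinearMap.norm_le_of_hasEigenvalue (isCompactOperator_convOp ψ)
      (isSymmetric_convOp ψ hψ) (Real.sqrt_nonneg _) fun z hz hev => ?_
    refine Real.le_sqrt_of_sq_le ?_
    rw [le_div_iff₀ hD]
    exact sq_norm_eigenvalue_convOp_le hG ψ hψ₀ hz hev
  calc ‖convOp ψ‖ ^ 2 * D ≤ √((∫ y, ψ y ^ 2 ∂μH) / D) ^ 2 * D := by gcongr
    _ = ∫ y, ψ y ^ 2 ∂μH := by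
      rw [Real.sq_sqrt (by positivity), div_mul_cancel₀ _ hD.ne']

end Convolution

/-! ### Mixing -/

section Mixing

variable {G : Type*} [Group G] [TopologicalSpace G] [IsTopologicalGroup G] [CompactSpace G]
  [T2Space G]

/-- Let `ψ` be the autocorrelation of `h` and `N = ∫ ψ²`. Then `N = ⟪h, ψ-convolution of h⟫` is at
most the operator norm, whose square is at most `N / D`; so `N ^ 2 * D ≤ N`, which bounds `N` by `1
/ D`. -/
theorem haarIntegral_sq_le_of_convolution {D : ℝ} (hD : 0 < D) (hG : IsQuasirandom D G)
    {h : G → ℝ} (hh : Continuous h) (h0 : haarIntegral h = 0)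
    (h1 : haarIntegral (fun x => h x ^ 2) ≤ 1) :
    haarIntegral (fun u => haarIntegral (fun x => h x * h (x * u)) ^ 2) ≤ 1 / D := by
  borelize G
  let ψ : C(G, ℝ) := ⟨fun u => haarIntegral fun x => h x * h (x * u),
    Continuous.haarIntegral_left (by fun_prop)⟩
  have hψ_def (u : G) : ψ u = haarIntegral fun x => h x * h (x * u) := rfl
  have hψ (u : G) : ψ u⁻¹ = ψ u := by
    rw [hψ_def, hψ_def, ← haarIntegral_mul_right _ u]
    · simp [mul_comm]
    · fun_prop
  have hψ₀ : haarIntegral ψ = 0 := by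
    change haarIntegral (fun u => haarIntegral fun x => h x * h (x * u)) = 0
    rw [haarIntegral_swap (by fun_prop)]
    simp only [haarIntegral_const_mul, haarIntegral_mul_left, h0]
    simp
  let f : BoundedContinuousFunction G ℂ :=
    BoundedContinuousFunction.mkOfCompact ⟨fun x => (h x : ℂ), by fun_prop⟩
  set N := haarIntegral (fun u => ψ u ^ 2) with hN
  have hop := sq_norm_convOp_le hD hG ψ hψ (by rw [← hψ₀, haarIntegral_eq_integral])
  rw [← haarIntegral_eq_integral (fun u => ψ u ^ 2), ← hN] at hop
  have hNin : (N : ℂ) = inner ℂ (BoundedContinuousFunction.toLp 2 _ ℂ f)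
      (convOp ψ (BoundedContinuousFunction.toLp 2 _ ℂ f)) := by
    rw [inner_convOp_toLp]
    have h2 : N = haarIntegral fun x => haarIntegral fun y => ψ (x⁻¹ * y) * h y * h x := by
      calc N = haarIntegral fun u => haarIntegral fun x => ψ u * (h x * h (x * u)) := by
            rw [hN]
            congr 1; funext u
            rw [haarIntegral_const_mul, sq, ← hψ_def]
        _ = haarIntegral fun x => haarIntegral fun u => ψ u * (h x * h (x * u)) :=
            haarIntegral_swap (by fun_prop)
        _ = _ := by
            congr 1; funext x
            rw [← haarIntegral_mul_left _ x⁻¹]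
            congr 1; funext y
            simp only [mul_inv_cancel_left]
            ring
    rw [h2]
    simp only [haarIntegral_eq_integral, ← integral_complex_ofReal]
    simp [f]
  have hf : ‖BoundedContinuousFunction.toLp 2
      (Measure.haarMeasure (⊤ : TopologicalSpace.PositiveCompacts G)) ℂ f‖ ^ 2 ≤ 1 := by
    rw [norm_sq_toLp]
    rw [haarIntegral_eq_integral] at h1
    simpa [f] using h1
  have hN0 : 0 ≤ N := haarIntegral_nonneg fun u => sq_nonneg _
  have hle : N ≤ ‖convOp ψ‖ := by
    calc N = ‖(N : ℂ)‖ := by simp [abs_of_nonneg hN0]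
      _ ≤ _ := by rw [hNin]; exact norm_inner_le_norm _ _
      _ ≤ _ := mul_le_mul_of_nonneg_left (ContinuousLinearMap.le_opNorm _ _) (norm_nonneg _)
      _ = ‖convOp ψ‖ * ‖BoundedContinuousFunction.toLp 2
        (Measure.haarMeasure (⊤ : TopologicalSpace.PositiveCompacts G)) ℂ f‖ ^ 2 := by ring
      _ ≤ ‖convOp ψ‖ := mul_le_of_le_one_right (norm_nonneg _) hf
  have hND : N ^ 2 * D ≤ N := le_trans (by gcongr) hop
  rw [le_div_iff₀ hD]
  change N * D ≤ 1
  rcases hN0.eq_or_lt with h | h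
  · rw [← h]; simp
  · nlinarith

/-- A `D`-quasirandom group is mixing in mean square, quantitatively. -/
theorem IsQuasirandom.mixing {D : ℝ} (hD : 0 < D) (hG : IsQuasirandom D G)
    {h : G → ℝ} (hh : Continuous h) (h1 : ∀ x, |h x| ≤ 1) :
    haarIntegral (fun u => (haarIntegral (fun x => h x * h (u * x)) - haarIntegral h ^ 2) ^ 2) ≤
      1 / D := by
  set m := haarIntegral h with hm
  -- Inversion turns the right translates of the convolution bound into left ones; subtracting `m`
  -- makes the mean zero.
  have key := haarIntegral_sq_le_of_convolution hD hG (h := fun x => h x⁻¹ - m) (by fun_prop)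
    (by rw [haarIntegral_sub (by fun_prop) (by fun_prop), haarIntegral_inv hh]; simp [hm]) (by
      have h2 : haarIntegral (fun x => (h x⁻¹ - m) ^ 2) =
          haarIntegral (fun x => h x⁻¹ ^ 2) - m ^ 2 := by
        have : (fun x => (h x⁻¹ - m) ^ 2) = fun x => (h x⁻¹ ^ 2 + (-(2 * m)) * h x⁻¹) + m ^ 2 := by
          funext x; ring
        rw [this, haarIntegral_add (by fun_prop) (by fun_prop),
          haarIntegral_add (by fun_prop) (by fun_prop), haarIntegral_const_mul,
          haarIntegral_inv hh, haarIntegral_const, ← hm]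
        ring
      rw [h2]
      have : haarIntegral (fun x => h x⁻¹ ^ 2) ≤ 1 :=
        haarIntegral_le_of_le (by fun_prop) fun x => by
          rw [← sq_abs]; exact pow_le_one₀ (abs_nonneg _) (h1 _)
      nlinarith [sq_nonneg m])
  refine le_trans (le_of_eq ?_) key
  rw [← haarIntegral_inv (by
    refine Continuous.pow (Continuous.sub (Continuous.haarIntegral_left ?_) continuous_const) 2
    fun_prop)]
  congr 1; funext u
  congr 1
  have h3 : (fun x => (h x⁻¹ - m) * (h (x * u)⁻¹ - m)) = fun x =>
      ((h x⁻¹ * h (x * u)⁻¹ + (-m) * h x⁻¹) + (-m) * h (x * u)⁻¹) + m ^ 2 := by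
    funext x; ring
  rw [h3, haarIntegral_add (by fun_prop) (by fun_prop),
    haarIntegral_add (by fun_prop) (by fun_prop), haarIntegral_add (by fun_prop) (by fun_prop),
    haarIntegral_const_mul, haarIntegral_const_mul, haarIntegral_inv hh,
    haarIntegral_mul_right (F := fun x => h x⁻¹) (by fun_prop) u, haarIntegral_inv hh,
    haarIntegral_const, ← hm, ← haarIntegral_inv (F := fun x => h x * h (u⁻¹ * x)) (by fun_prop)]
  simp only [mul_inv_rev]
  ring

end Mixing

/-! ### Box integrals along a sequence of group actions -/

section Box

universe u

variable {G X : Type u} [Group G] [Group X]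

/-- The multiplicative derivative of `F` along `σ u`. -/
def mulDeriv (σ : G →* X) (u : G) (F : X → ℝ) : X → ℝ := fun x => F x * F (σ u * x)

theorem abs_prod_le_one {ι : Type*} (s : Finset ι) (f : ι → ℝ) (h : ∀ i ∈ s, |f i| ≤ 1) :
    |∏ i ∈ s, f i| ≤ 1 := by
  rw [Finset.abs_prod]
  exact Finset.prod_le_one (fun i _ => abs_nonneg _) h

theorem abs_mul_le_one {a b : ℝ} (ha : |a| ≤ 1) (hb : |b| ≤ 1) : |a * b| ≤ 1 := by
  rw [abs_mul]
  exact mul_le_one₀ ha (abs_nonneg _) hb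

theorem abs_mulDeriv_le_one (σ : G →* X) (u : G) {F : X → ℝ} (hF : ∀ x, |F x| ≤ 1) (x : X) :
    |mulDeriv σ u F x| ≤ 1 :=
  abs_mul_le_one (hF _) (hF _)

variable [TopologicalSpace X] [IsTopologicalGroup X]

/-- Products of `m` bounded continuous functions, the `i`-th of which is invariant under the
left action of `G` through `σ i`. -/
def invProducts (σ : ℕ → G →* X) (m : ℕ) : Set (X → ℝ) :=
  {Φ | ∃ φ : ℕ → X → ℝ, (∀ i, Continuous (φ i)) ∧ (∀ i x, |φ i x| ≤ 1) ∧
    (∀ i < m, ∀ v x, φ i (σ i v * x) = φ i x) ∧ Φ = fun x => ∏ i ∈ Finset.range m, φ i x}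

theorem continuous_mulDeriv_apply (σ : G →* X) (u : G) {F : X → ℝ} (hF : Continuous F) :
    Continuous (mulDeriv σ u F) := by
  unfold mulDeriv
  fun_prop

variable [TopologicalSpace G]

theorem continuous_mulDeriv_uncurry {P : Type*} [TopologicalSpace P] {σ : G →* X}
    (hσ : Continuous σ) {F : P → X → ℝ} (hF : Continuous fun p : P × X => F p.1 p.2) :
    Continuous fun q : (P × G) × X => mulDeriv σ q.1.2 (F q.1.1) q.2 := by
  unfold mulDeriv
  exact (hF.comp (by fun_prop : Continuous fun q : (P × G) × X => (q.1.1, q.2))).mul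
    (hF.comp (by fun_prop : Continuous fun q : (P × G) × X => (q.1.1, σ q.1.2 * q.2)))

theorem continuous_mulDeriv {σ : G →* X} (hσ : Continuous σ) {F : X → ℝ} (hF : Continuous F) :
    Continuous fun q : G × X => mulDeriv σ q.1 F q.2 := by
  unfold mulDeriv
  fun_prop

variable [IsTopologicalGroup G] [CompactSpace G] [CompactSpace X]

/-- The average of `F` over all `m`-dimensional parallelepipeds spanned by the actions of `G`
through `σ 0, …, σ (m - 1)`. -/
noncomputable def boxInt (σ : ℕ → G →* X) : ℕ → (X → ℝ) → ℝ
  | 0, F => haarIntegral F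
  | m + 1, F => haarIntegral fun u : G => boxInt σ m (mulDeriv (σ m) u F)

/-- The average of the square of the average of `F` over all `m`-dimensional parallelepipeds
with given sides. -/
noncomputable def boxSq (σ : ℕ → G →* X) : ℕ → (X → ℝ) → ℝ
  | 0, F => haarIntegral F ^ 2
  | m + 1, F => haarIntegral fun u : G => boxSq σ m (mulDeriv (σ m) u F)

theorem continuous_boxInt {σ : ℕ → G →* X} (hσ : ∀ i, Continuous (σ i)) (m : ℕ) {P : Type u}
    [TopologicalSpace P] {F : P → X → ℝ} (hF : Continuous fun p : P × X => F p.1 p.2) :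
    Continuous fun p => boxInt σ m (F p) := by
  induction m generalizing P with
  | zero => exact Continuous.haarIntegral_left hF
  | succ m ih =>
    exact Continuous.haarIntegral_left (ih (continuous_mulDeriv_uncurry (hσ m) hF))

/-- Both sides are the squared norm of the projection of `K` to the `σ`-invariant functions, which
is averaging over orbits. -/
theorem haarIntegral_mulDeriv {σ : G →* X} (hσ : Continuous σ) {K : X → ℝ} (hK : Continuous K) :
    haarIntegral (fun u : G => haarIntegral (mulDeriv σ u K)) =
      haarIntegral fun x => haarIntegral (fun u : G => K (σ u * x)) ^ 2 := by
  have h1 : (fun x => haarIntegral (fun u : G => K (σ u * x)) ^ 2) = fun x =>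
      haarIntegral fun u : G => haarIntegral fun v : G => K (σ u * x) * K (σ v * x) := by
    funext x
    simp only [haarIntegral_const_mul, haarIntegral_mul_const, sq]
  rw [h1, haarIntegral_swap (H := X) (K := G) (by exact Continuous.haarIntegral_left (by fun_prop)),
    ← haarIntegral_const (H := G) (haarIntegral fun u : G => haarIntegral (mulDeriv σ u K))]
  congr 1; funext u
  rw [haarIntegral_swap (H := X) (K := G) (by fun_prop), ← haarIntegral_mul_right _ u⁻¹]
  · congr 1; funext v
    rw [← haarIntegral_mul_left _ (σ u)]
    simp only [mulDeriv, map_mul, map_inv, mul_assoc, inv_mul_cancel_left]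
  · exact Continuous.haarIntegral_left (continuous_mulDeriv hσ hK)

/-- Against an invariant `φ`, the function `K` may be replaced by its orbit average; Cauchy–Schwarz
then discards `φ`. -/
theorem sq_haarIntegral_mul_invariant_le {σ : G →* X} (hσ : Continuous σ) {K φ : X → ℝ}
    (hK : Continuous K) (hφ : Continuous φ) (hφ1 : ∀ x, |φ x| ≤ 1)
    (hφσ : ∀ v x, φ (σ v * x) = φ x) :
    haarIntegral (fun x => K x * φ x) ^ 2 ≤
      haarIntegral fun u : G => haarIntegral (mulDeriv σ u K) := by
  have h1 : haarIntegral (fun x => K x * φ x) =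
      haarIntegral fun x => haarIntegral (fun u : G => K (σ u * x)) * φ x := by
    simp only [← haarIntegral_mul_const]
    rw [haarIntegral_swap (by fun_prop),
      ← haarIntegral_const (H := G) (haarIntegral fun x => K x * φ x)]
    congr 1; funext u
    rw [← haarIntegral_mul_left _ (σ u)]
    simp only [hφσ]
  have hc : Continuous fun x => haarIntegral fun u : G => K (σ u * x) :=
    Continuous.haarIntegral_left (by fun_prop)
  rw [h1, haarIntegral_mulDeriv hσ hK]
  refine (haarIntegral_mul_sq_le hc hφ).trans (mul_le_of_le_one_right ?_ ?_)
  · exact haarIntegral_nonneg fun x => sq_nonneg _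
  · refine haarIntegral_le_of_le (by fun_prop) fun x => ?_
    rw [← sq_abs]
    exact pow_le_one₀ (abs_nonneg _) (hφ1 x)

/-- The Gowers–Cauchy–Schwarz inequality for box integrals. -/
theorem pow_haarIntegral_mul_prod_le_boxInt {σ : ℕ → G →* X} (hσ : ∀ i, Continuous (σ i))
    (hcomm : ∀ i j, i < j → ∀ u v, σ j u * σ i v = σ i (u * v * u⁻¹) * σ j u) (m : ℕ)
    {F : X → ℝ} (hF : Continuous F) {Φ : X → ℝ} (hΦ : Φ ∈ invProducts σ m) :
    haarIntegral (fun x => F x * Φ x) ^ 2 ^ m ≤ boxInt σ m F := by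
  obtain ⟨φ, hφ, hφ1, hφσ, rfl⟩ := hΦ
  induction m generalizing F φ with
  | zero => simp [boxInt]
  | succ m ih =>
    have hA : Continuous fun u : G => haarIntegral fun x => mulDeriv (σ m) u F x *
        ∏ i ∈ Finset.range m, mulDeriv (σ m) u (φ i) x := by
      refine Continuous.haarIntegral_left ((continuous_mulDeriv (hσ m) hF).mul ?_)
      exact continuous_finsetProd _ fun i _ => continuous_mulDeriv (hσ m) (hφ i)
    have h1 : haarIntegral (fun x => F x * ∏ i ∈ Finset.range (m + 1), φ i x) ^ 2 ≤
        haarIntegral fun u : G => haarIntegral fun x => mulDeriv (σ m) u F x *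
          ∏ i ∈ Finset.range m, mulDeriv (σ m) u (φ i) x := by
      have := sq_haarIntegral_mul_invariant_le (hσ m)
        (K := fun x => F x * ∏ i ∈ Finset.range m, φ i x)
        (hF.mul (continuous_finsetProd _ fun i _ => hφ i)) (hφ m) (hφ1 m)
        (hφσ m (Nat.lt_succ_self m))
      simp only [Finset.prod_range_succ, ← mul_assoc]
      refine this.trans (le_of_eq ?_)
      congr 1; funext u
      congr 1; funext x
      simp only [mulDeriv, Finset.prod_mul_distrib]
      ring
    rw [pow_succ', pow_mul]
    refine (pow_le_pow_left₀ (sq_nonneg _) h1 _).trans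
      ((haarIntegral_pow_two_pow_le hA m).trans ?_)
    refine haarIntegral_mono (hA.pow _)
      (continuous_boxInt hσ m (continuous_mulDeriv (hσ m) hF)) fun u => ?_
    refine ih (continuous_mulDeriv_apply (σ m) u hF) (fun i => mulDeriv (σ m) u (φ i))
      (fun i => continuous_mulDeriv_apply (σ m) u (hφ i))
      (fun i => abs_mulDeriv_le_one (σ m) u (hφ1 i)) fun i hi v x => ?_
    have hi' := hφσ i (hi.trans (Nat.lt_succ_self m))
    simp only [mulDeriv]
    -- Since `σ m u` conjugates the image of `σ i` into itself, differentiating along `σ m`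
    -- preserves invariance under `σ i`.
    rw [hi', ← mul_assoc, hcomm i m hi, mul_assoc, hi']

/-- A box integral is at most the correlation with a family of products of invariant functions;
version with parameters. -/
theorem exists_haarIntegral_boxInt_le {σ : ℕ → G →* X} (hσ : ∀ i, Continuous (σ i)) {k : ℕ}
    {π : ℕ → X → G} (hπ : ∀ i, Continuous (π i))
    (hπ_self : ∀ i < k, ∀ v x, π i (σ i v * x) = v * π i x)
    (hπ_lt : ∀ i j, i < j → j < k → ∀ v x, π j (σ i v * x) = π j x)
    (m : ℕ) (hm : m ≤ k) {P : Type u} [Group P] [TopologicalSpace P] [IsTopologicalGroup P]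
    [CompactSpace P] {F : P → X → ℝ} (hF : Continuous fun p : P × X => F p.1 p.2)
    (hF1 : ∀ p x, |F p x| ≤ 1) :
    ∃ φ : ℕ → P → X → ℝ, (∀ i, Continuous fun p : P × X => φ i p.1 p.2) ∧
      (∀ i p x, |φ i p x| ≤ 1) ∧ (∀ i < m, ∀ p v x, φ i p (σ i v * x) = φ i p x) ∧
      haarIntegral (fun p => boxInt σ m (F p)) ≤
        haarIntegral fun p => haarIntegral fun x => F p x * ∏ i ∈ Finset.range m, φ i p x := by
  induction m generalizing P with
  | zero => exact ⟨fun _ _ _ => 1, fun i => continuous_const, by simp, by simp, by simp [boxInt]⟩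
  | succ m ih =>
    have hFd := continuous_mulDeriv_uncurry (hσ m) hF
    obtain ⟨φ, hφ, hφ1, hφσ, hle⟩ := ih (by omega) (P := P × G)
      (F := fun q => mulDeriv (σ m) q.2 (F q.1)) hFd
      (fun q => abs_mulDeriv_le_one (σ m) q.2 (hF1 q.1))
    have hcB {Y : Type u} [TopologicalSpace Y] {a : Y → P} {b : Y → G} {c : Y → X}
        (ha : Continuous a) (hb : Continuous b) (hc : Continuous c) :
        Continuous fun y => mulDeriv (σ m) (b y) (F (a y)) (c y) *
          ∏ i ∈ Finset.range m, φ i (a y, b y) (c y) :=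
      (hFd.comp ((ha.prodMk hb).prodMk hc)).mul
        (continuous_finsetProd _ fun i _ => (hφ i).comp ((ha.prodMk hb).prodMk hc))
    have hπm := hπ m
    -- For fixed `x`, substitute `u = b * (π m x)⁻¹` for the side `u`. As `π m` is equivariant under
    -- `σ m`, the vertex `σ m u * x` becomes a `σ m`-invariant function of `x`.
    have hle2 : haarIntegral (fun p => boxInt σ (m + 1) (F p)) ≤
        haarIntegral fun b : G => haarIntegral fun p => haarIntegral fun x =>
          mulDeriv (σ m) (b * (π m x)⁻¹) (F p) x *
            ∏ i ∈ Finset.range m, φ i (p, b * (π m x)⁻¹) x := by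
      rw [haarIntegral_prod (continuous_boxInt hσ m hFd), haarIntegral_prod
        (Continuous.haarIntegral_left (hcB (by fun_prop) (by fun_prop) (by fun_prop)))] at hle
      refine hle.trans (le_of_eq ?_)
      rw [haarIntegral_swap (H := G) (K := P) (by
        exact Continuous.haarIntegral_left (hcB (by fun_prop) (by fun_prop) (by fun_prop)))]
      congr 1; funext p
      rw [haarIntegral_swap (H := G) (K := X)
          (by exact hcB (by fun_prop) (by fun_prop) (by fun_prop)),
        haarIntegral_swap (H := G) (K := X)
          (by exact hcB (by fun_prop) (by fun_prop) (by fun_prop))]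
      congr 1; funext x
      exact (haarIntegral_mul_right (F := fun u => mulDeriv (σ m) u (F p) x *
        ∏ i ∈ Finset.range m, φ i (p, u) x) (hcB (by fun_prop) (by fun_prop) (by fun_prop))
        (π m x)⁻¹).symm
    obtain ⟨b, hb⟩ := exists_haarIntegral_le (F := fun b : G => haarIntegral fun p =>
      haarIntegral fun x => mulDeriv (σ m) (b * (π m x)⁻¹) (F p) x *
        ∏ i ∈ Finset.range m, φ i (p, b * (π m x)⁻¹) x)
      (Continuous.haarIntegral_left (Continuous.haarIntegral_left
        (hcB (by fun_prop) (by fun_prop) (by fun_prop))))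
    -- With the best `b` fixed, the old `φ i` stay `σ i`-invariant because `π m` is, and the new
    -- factor sits at `i = m`. Indices beyond `m` only need continuity and the bound.
    refine ⟨fun i p x => if i < m then φ i (p, b * (π m x)⁻¹) x
      else F p (σ m (b * (π m x)⁻¹) * x), fun i => ?_, fun i p x => ?_, fun i hi p v x => ?_,
      (hle2.trans hb).trans (le_of_eq ?_)⟩
    · have hσm := hσ m
      by_cases him : i < m
      · simp only [him, if_true]
        exact (hφ i).comp (by fun_prop :
          Continuous fun q : P × X => ((q.1, b * (π m q.2)⁻¹), q.2))
      · simp only [him, if_false]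
        exact hF.comp (by fun_prop :
          Continuous fun q : P × X => (q.1, σ m (b * (π m q.2)⁻¹) * q.2))
    · dsimp only
      split_ifs
      exacts [hφ1 _ _ _, hF1 _ _]
    · rcases (Nat.lt_succ_iff_lt_or_eq.1 hi) with him | rfl
      · simp only [him, if_true]
        rw [hπ_lt i m him (by omega), hφσ i him]
      · simp only [lt_irrefl, if_false]
        rw [hπ_self i (by omega)]
        simp [mul_assoc]
    · congr 1; funext p
      congr 1; funext x
      rw [Finset.prod_range_succ, Finset.prod_congr rfl fun i hi => if_pos (Finset.mem_range.1 hi)]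
      simp only [lt_irrefl, if_false, mulDeriv]
      ring

theorem exists_boxInt_le {σ : ℕ → G →* X} (hσ : ∀ i, Continuous (σ i)) {k : ℕ}
    {π : ℕ → X → G} (hπ : ∀ i, Continuous (π i))
    (hπ_self : ∀ i < k, ∀ v x, π i (σ i v * x) = v * π i x)
    (hπ_lt : ∀ i j, i < j → j < k → ∀ v x, π j (σ i v * x) = π j x)
    {F : X → ℝ} (hF : Continuous F) (hF1 : ∀ x, |F x| ≤ 1) :
    ∃ Φ ∈ invProducts σ k, boxInt σ k F ≤ haarIntegral fun x => F x * Φ x := by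
  obtain ⟨φ, hφ, hφ1, hφσ, hle⟩ := exists_haarIntegral_boxInt_le hσ hπ hπ_self hπ_lt k le_rfl
    (P := PUnit.{u + 1}) (F := fun _ => F) (by fun_prop) (fun _ => hF1)
  refine ⟨_, ⟨fun i => φ i 1, fun i => (hφ i).comp (by fun_prop :
    Continuous fun x : X => ((1 : PUnit.{u + 1}), x)), fun i => hφ1 i 1,
    fun i hi => hφσ i hi 1, rfl⟩, ?_⟩
  simpa only [haarIntegral_unique] using hle

/-- Squares of integrals become integrals over `X × X`. The idle factor `G` makes room for the
variable `g` of the correlation sequence. -/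
theorem boxInt_tensor {σ : ℕ → G →* X} (m : ℕ) {F : X → ℝ}
    (hF : Continuous F) :
    boxInt (fun i => (MonoidHom.id G).prod ((σ i).prod (σ i))) m
      (fun z : G × X × X => F z.2.1 * F z.2.2) = boxSq σ m F := by
  induction m generalizing F with
  | zero =>
    simp only [boxInt, boxSq]
    rw [haarIntegral_prod (by fun_prop)]
    simp only
    rw [haarIntegral_const, haarIntegral_prod (by fun_prop)]
    simp only [haarIntegral_const_mul, haarIntegral_mul_const, sq]
  | succ m ih =>
    simp only [boxInt, boxSq]
    congr 1; funext u
    rw [← ih (continuous_mulDeriv_apply (σ m) u hF)]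
    congr 1; funext z
    simp [mulDeriv]
    ring

theorem continuous_boxSq_mulDeriv {σ : ℕ → G →* X} (hσ : ∀ i, Continuous (σ i)) (m : ℕ) {F : X → ℝ}
    (hF : Continuous F) : Continuous fun u : G => boxSq σ m (mulDeriv (σ m) u F) := by
  simp only [← boxInt_tensor m (continuous_mulDeriv_apply (σ m) _ hF)]
  have hc := continuous_mulDeriv (hσ m) hF
  refine continuous_boxInt (fun i => ?_) m (Continuous.mul
    (hc.comp (by fun_prop : Continuous fun q : G × G × X × X => (q.1, q.2.2.1)))
    (hc.comp (by fun_prop : Continuous fun q : G × G × X × X => (q.1, q.2.2.2))))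
  exact continuous_id.prodMk ((hσ i).prodMk (hσ i))

/-- Mixing on each orbit shows that the correlation at `u` is `M + R u`, with `R` of mean zero and
`∫ R² ≤ 1 / D`. So the mean square is at most `M ^ 2 + 1 / D`, and `M ^ 2 ≤ M` because `0 ≤ M ≤ 1`.
-/
theorem haarIntegral_sq_mulDeriv_le [T2Space G] {D : ℝ} (hD : 0 < D) (hG : IsQuasirandom D G)
    {σ : G →* X} (hσ : Continuous σ) {F : X → ℝ} (hF : Continuous F) (hF1 : ∀ x, |F x| ≤ 1) :
    haarIntegral (fun u : G => haarIntegral (mulDeriv σ u F) ^ 2) ≤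
      haarIntegral (fun u : G => haarIntegral (mulDeriv σ u F)) + 1 / D := by
  set ψ : X → G → ℝ := fun x u => haarIntegral fun v : G => F (σ v * x) * F (σ (u * v) * x) with hψ
  set mean : X → ℝ := fun x => haarIntegral fun v : G => F (σ v * x) with hmean
  have hψc : Continuous fun q : X × G => ψ q.1 q.2 := Continuous.haarIntegral_left (by fun_prop)
  have hmc : Continuous mean := Continuous.haarIntegral_left (by fun_prop)
  set M := haarIntegral (fun u : G => haarIntegral (mulDeriv σ u F)) with hM
  have hM' : M = haarIntegral fun x => mean x ^ 2 := haarIntegral_mulDeriv hσ hF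
  have hmean1 (x : X) : mean x ^ 2 ≤ 1 := by
    rw [← sq_abs]
    exact pow_le_one₀ (abs_nonneg _)
      (abs_haarIntegral_le_of_le (by fun_prop) fun v => hF1 _)
  have hM0 : 0 ≤ M := by rw [hM']; exact haarIntegral_nonneg fun x => sq_nonneg _
  have hM1 : M ≤ 1 := by rw [hM']; exact haarIntegral_le_of_le (by fun_prop) hmean1
  have h1 (u : G) : haarIntegral (mulDeriv σ u F) = haarIntegral fun x => ψ x u := by
    simp only [hψ]
    rw [haarIntegral_swap (by fun_prop),
      ← haarIntegral_const (H := G) (haarIntegral (mulDeriv σ u F))]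
    congr 1; funext v
    rw [← haarIntegral_mul_left _ (σ v)]
    simp only [mulDeriv, map_mul, mul_assoc]
  set R : G → ℝ := fun u => haarIntegral fun x => ψ x u - mean x ^ 2 with hR
  have hRc : Continuous R := Continuous.haarIntegral_left
    (Continuous.sub (hψc.comp continuous_swap) (by fun_prop))
  have hψu (u : G) : Continuous fun x => ψ x u :=
    hψc.comp (by fun_prop : Continuous fun x : X => (x, u))
  have h2 (u : G) : haarIntegral (mulDeriv σ u F) = R u + M := by
    rw [h1, hR, hM']
    simp only
    rw [haarIntegral_sub (hψu u) (by fun_prop)]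
    ring
  have hR0 : haarIntegral R = 0 := by
    have : haarIntegral (fun u => R u + M) = M := by simp only [← h2]; rfl
    rw [haarIntegral_add hRc continuous_const, haarIntegral_const] at this
    linarith
  have hR2 : haarIntegral (fun u => R u ^ 2) ≤ 1 / D := by
    have hc : Continuous fun q : G × X => (ψ q.2 q.1 - mean q.2 ^ 2) ^ 2 :=
      ((hψc.comp continuous_swap).sub (by fun_prop)).pow 2
    calc haarIntegral (fun u => R u ^ 2)
        ≤ haarIntegral fun u => haarIntegral fun x => (ψ x u - mean x ^ 2) ^ 2 :=
          haarIntegral_mono (hRc.pow 2) (Continuous.haarIntegral_left hc)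
            fun u => sq_haarIntegral_le ((hψu u).sub (by fun_prop))
      _ = haarIntegral fun x => haarIntegral fun u => (ψ x u - mean x ^ 2) ^ 2 :=
          haarIntegral_swap hc
      _ ≤ 1 / D := by
          refine haarIntegral_le_of_le (Continuous.haarIntegral_left (hc.comp continuous_swap))
            fun x => ?_
          exact hG.mixing hD (h := fun v => F (σ v * x)) (by fun_prop) fun v => hF1 _
  have h3 : (fun u => haarIntegral (mulDeriv σ u F) ^ 2) =
      fun u => (R u ^ 2 + 2 * M * R u) + M ^ 2 := by
    funext u; rw [h2]; ring
  rw [h3, haarIntegral_add (by fun_prop) (by fun_prop), haarIntegral_add (by fun_prop)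
    (by fun_prop), haarIntegral_const_mul, hR0, haarIntegral_const]
  nlinarith

/-- Mixing is needed only for the innermost derivative, along `σ 0`; the others are averaged over,
so the error does not grow with `m`. -/
theorem boxSq_le_boxInt_add [T2Space G] {D : ℝ} (hD : 0 < D) (hG : IsQuasirandom D G)
    {σ : ℕ → G →* X} (hσ : ∀ i, Continuous (σ i)) (m : ℕ) {F : X → ℝ} (hF : Continuous F)
    (hF1 : ∀ x, |F x| ≤ 1) : boxSq σ (m + 1) F ≤ boxInt σ (m + 1) F + 1 / D := by
  induction m generalizing F with
  | zero => exact haarIntegral_sq_mulDeriv_le hD hG (hσ 0) hF hF1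
  | succ m ih =>
    have hc := continuous_boxInt hσ (m + 1) (F := fun u => mulDeriv (σ (m + 1)) u F)
      (continuous_mulDeriv (hσ (m + 1)) hF)
    have h := haarIntegral_mono (continuous_boxSq_mulDeriv hσ (m + 1) hF)
      (F' := fun u => boxInt σ (m + 1) (mulDeriv (σ (m + 1)) u F) + 1 / D)
      (hc.add continuous_const) fun u =>
        ih (continuous_mulDeriv_apply (σ (m + 1)) u hF) (abs_mulDeriv_le_one (σ (m + 1)) u hF1)
    rwa [haarIntegral_add hc continuous_const, haarIntegral_const] at h

theorem pow_haarIntegral_sq_correlation_le_boxInt [T2Space G] {D : ℝ} (hD : 0 < D)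
    (hG : IsQuasirandom D G) {σ : ℕ → G →* X} (hσ : ∀ i, Continuous (σ i))
    (hcomm : ∀ i j, i < j → ∀ u v, σ j u * σ i v = σ i (u * v * u⁻¹) * σ j u) (m : ℕ)
    {F : X → ℝ} (hF : Continuous F) (hF1 : ∀ x, |F x| ≤ 1) {f : ℕ → X → ℝ}
    (hf : ∀ i, Continuous (f i)) (hf1 : ∀ i x, |f i x| ≤ 1) :
    haarIntegral (fun g : G => haarIntegral (fun x =>
      F x * ∏ i ∈ Finset.range (m + 1), f i (σ i g * x)) ^ 2) ^ 2 ^ (m + 1) ≤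
      boxInt σ (m + 1) F + 1 / D := by
  refine le_trans ?_ (boxSq_le_boxInt_add hD hG hσ m hF hF1)
  rw [← boxInt_tensor (m + 1) hF]
  have hcont (i : ℕ) : Continuous ((MonoidHom.id G).prod ((σ i).prod (σ i))) :=
    continuous_id.prodMk ((hσ i).prodMk (hσ i))
  have hc {Y : Type u} [TopologicalSpace Y] {a : Y → G} {b : Y → X} (ha : Continuous a)
      (hb : Continuous b) : Continuous fun y =>
        F (b y) * ∏ i ∈ Finset.range (m + 1), f i (σ i (a y) * b y) := by
    refine (hF.comp hb).mul (continuous_finsetProd _ fun i _ => ?_)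
    have := hσ i
    have := hf i
    fun_prop
  -- With `g⁻¹` in place of `g`, the factor `f i (σ i g⁻¹ * x)` is invariant under `(g, x) ↦ (v * g,
  -- σ i v * x)`.
  have key := pow_haarIntegral_mul_prod_le_boxInt (σ := fun i => (MonoidHom.id G).prod
    ((σ i).prod (σ i))) hcont (fun i j hij u v => by simp [hcomm i j hij]) (m + 1)
    (F := fun z : G × X × X => F z.2.1 * F z.2.2) (by fun_prop)
    (Φ := fun z => ∏ i ∈ Finset.range (m + 1),
      (f i (σ i z.1⁻¹ * z.2.1) * f i (σ i z.1⁻¹ * z.2.2)))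
    ⟨fun i z => f i (σ i z.1⁻¹ * z.2.1) * f i (σ i z.1⁻¹ * z.2.2), fun i => by
      have := hσ i
      have := hf i
      fun_prop, fun i z => abs_mul_le_one (hf1 _ _) (hf1 _ _), fun i _ v z => by
        simp [mul_assoc], rfl⟩
  refine le_trans (le_of_eq ?_) key
  congr 1
  have hprod : (fun z : G × X × X => F z.2.1 * F z.2.2 * ∏ i ∈ Finset.range (m + 1),
      (f i (σ i z.1⁻¹ * z.2.1) * f i (σ i z.1⁻¹ * z.2.2))) = fun z =>
      (F z.2.1 * ∏ i ∈ Finset.range (m + 1), f i (σ i z.1⁻¹ * z.2.1)) *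
        (F z.2.2 * ∏ i ∈ Finset.range (m + 1), f i (σ i z.1⁻¹ * z.2.2)) := by
    funext z
    rw [Finset.prod_mul_distrib]
    ring
  rw [hprod, haarIntegral_prod (by
    exact (hc (by fun_prop) (by fun_prop)).mul (hc (by fun_prop) (by fun_prop))),
    ← haarIntegral_inv (by
      exact (Continuous.haarIntegral_left (hc (by fun_prop) (by fun_prop))).pow 2)]
  congr 1; funext g
  rw [haarIntegral_prod (by
    exact (hc (by fun_prop) (by fun_prop)).mul (hc (by fun_prop) (by fun_prop)))]
  simp only [haarIntegral_const_mul, haarIntegral_mul_const, sq]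

/-- If `F` does not correlate with products of invariant functions, then its multiple correlation
sequences with other functions are small in mean square. -/
theorem pow_haarIntegral_sq_correlation_le [T2Space G] {D : ℝ} (hD : 0 < D)
    (hG : IsQuasirandom D G) {σ : ℕ → G →* X} (hσ : ∀ i, Continuous (σ i))
    (hcomm : ∀ i j, i < j → ∀ u v, σ j u * σ i v = σ i (u * v * u⁻¹) * σ j u) {m : ℕ}
    {π : ℕ → X → G} (hπ : ∀ i, Continuous (π i))
    (hπ_self : ∀ i < m + 1, ∀ v x, π i (σ i v * x) = v * π i x)
    (hπ_lt : ∀ i j, i < j → j < m + 1 → ∀ v x, π j (σ i v * x) = π j x)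
    {F : X → ℝ} (hF : Continuous F) (hF1 : ∀ x, |F x| ≤ 1) {ε : ℝ}
    (hFε : ∀ Φ ∈ invProducts σ (m + 1), |haarIntegral fun x => F x * Φ x| ≤ ε) {f : ℕ → X → ℝ}
    (hf : ∀ i, Continuous (f i)) (hf1 : ∀ i x, |f i x| ≤ 1) :
    haarIntegral (fun g : G => haarIntegral (fun x =>
      F x * ∏ i ∈ Finset.range (m + 1), f i (σ i g * x)) ^ 2) ^ 2 ^ (m + 1) ≤ ε + 1 / D := by
  obtain ⟨Φ, hΦ, hle⟩ := exists_boxInt_le hσ hπ hπ_self hπ_lt hF hF1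
  have h1 := pow_haarIntegral_sq_correlation_le_boxInt hD hG hσ hcomm m hF hF1 hf hf1
  have h2 := (le_abs_self _).trans (hFε Φ hΦ)
  linarith

end Box

/-! ### Approximation by combinations of structured functions -/

/-- `BoundedComb K A s`: the function `s` is a linear combination of members of `K` with
coefficients of total absolute value at most `A`. -/
inductive BoundedComb {X : Type*} (K : Set (X → ℝ)) : ℝ → (X → ℝ) → Prop
  | atom {A c : ℝ} {Φ : X → ℝ} (hΦ : Φ ∈ K) (hc : |c| ≤ A) : BoundedComb K A fun x => c * Φ x
  | add {A B : ℝ} {s t : X → ℝ} (hs : BoundedComb K A s) (ht : BoundedComb K B t) :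
      BoundedComb K (A + B) fun x => s x + t x

namespace BoundedComb

variable {X : Type*} {K : Set (X → ℝ)} {A B : ℝ} {s t : X → ℝ}

theorem mono (hs : BoundedComb K A s) (hAB : A ≤ B) : BoundedComb K B s := by
  induction hs generalizing B with
  | atom hΦ hc => exact .atom hΦ (hc.trans hAB)
  | @add A A' s t hs ht ih ih' =>
    have h := BoundedComb.add hs (ih' (B := B - A) (by linarith))
    rwa [add_sub_cancel] at h

theorem continuous [TopologicalSpace X] (hK : ∀ Φ ∈ K, Continuous Φ) (hs : BoundedComb K A s) :
    Continuous s := by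
  induction hs with
  | atom hΦ _ => exact continuous_const.mul (hK _ hΦ)
  | add _ _ ih ih' => exact ih.add ih'

theorem const (h1 : (fun _ => 1) ∈ K) (c : ℝ) : BoundedComb K |c| fun _ => c := by
  simpa using BoundedComb.atom (c := c) h1 le_rfl

theorem mul (hK : ∀ Φ ∈ K, ∀ Ψ ∈ K, (fun x => Φ x * Ψ x) ∈ K) (hs : BoundedComb K A s)
    (ht : BoundedComb K B t) : BoundedComb K (A * B) fun x => s x * t x := by
  induction hs with
  | @atom A c Φ hΦ hc =>
    induction ht with
    | @atom B d Ψ hΨ hd =>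
      have h := BoundedComb.atom (c := c * d) (A := A * B) (hK Φ hΦ Ψ hΨ) (by
        rw [abs_mul]
        exact mul_le_mul hc hd (abs_nonneg _) ((abs_nonneg _).trans hc))
      convert h using 2
      ring
    | add _ _ ih ih' =>
      convert ih.add ih' using 1
      · ring
      · funext x; ring
  | add _ _ ih ih' =>
    convert ih.add ih' using 1
    · ring
    · funext x; ring

theorem pow (h1 : (fun _ => 1) ∈ K) (hK : ∀ Φ ∈ K, ∀ Ψ ∈ K, (fun x => Φ x * Ψ x) ∈ K)
    (hs : BoundedComb K A s) (n : ℕ) : BoundedComb K (A ^ n) fun x => s x ^ n := by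
  induction n with
  | zero => simpa using const h1 1
  | succ n ih => simpa only [pow_succ] using ih.mul hK hs

theorem eval (h1 : (fun _ => 1) ∈ K) (hK : ∀ Φ ∈ K, ∀ Ψ ∈ K, (fun x => Φ x * Ψ x) ∈ K)
    (hs : BoundedComb K A s) (q : Polynomial ℝ) :
    BoundedComb K (∑ i ∈ Finset.range (q.natDegree + 1), |q.coeff i| * A ^ i)
      fun x => q.eval (s x) := by
  simp only [Polynomial.eval_eq_sum_range]
  induction Finset.range (q.natDegree + 1) using Finset.induction_on with
  | empty => simpa using const h1 0
  | insert i S hi ih =>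
    simp only [Finset.sum_insert hi]
    exact ((const h1 (q.coeff i)).mul hK (hs.pow h1 hK i)).add ih

end BoundedComb

/-- Projecting to `[-1, 1]` can be done up to a small error by a polynomial. -/
theorem exists_polynomial_near_clip {η : ℝ} (hη : 0 < η) (R : ℝ) :
    ∃ q : Polynomial ℝ, ∀ t, |t| ≤ R → |q.eval t - max (-1) (min 1 t)| < η := by
  obtain ⟨q, hq⟩ := exists_polynomial_near_of_continuousOn (-R) R
    (fun t => max (-1) (min 1 t)) (by fun_prop) η hη
  exact ⟨q, fun t ht => hq t (abs_le.1 ht)⟩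

theorem abs_sub_clip_le {y : ℝ} (hy : |y| ≤ 1) (t : ℝ) : |y - max (-1) (min 1 t)| ≤ |y - t| := by
  rw [abs_le] at hy
  have h : y = max (-1) (min 1 y) := by
    rw [min_eq_right hy.2, max_eq_right hy.1]
  calc |y - max (-1) (min 1 t)| = |max (-1) (min 1 y) - max (-1) (min 1 t)| := by rw [← h]
    _ ≤ |min 1 y - min 1 t| := by
      simpa only [max_comm (-1 : ℝ)] using abs_max_sub_max_le_abs (min 1 y) (min 1 t) (-1)
    _ ≤ |y - t| := by
      simpa only [min_comm (1 : ℝ), sub_self, abs_zero, max_eq_left (abs_nonneg (y - t))]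
        using abs_min_sub_min_le_max y 1 t 1

theorem abs_clip_le_one (t : ℝ) : |max (-1) (min 1 t)| ≤ 1 :=
  abs_le.2 ⟨le_max_left _ _, max_le (by norm_num) (min_le_left _ _)⟩

/-- A bounded function is, up to an error which correlates with no member of `K`, a bounded
combination of members of `K`, of complexity bounded in terms of `ε` only. -/
theorem exists_boundedComb_near.{u} {ε : ℝ} (hε : 0 < ε) :
    ∃ A : ℝ, ∀ {X : Type u} [Group X] [TopologicalSpace X] [IsTopologicalGroup X] [CompactSpace X]
      (K : Set (X → ℝ)), (∀ Φ ∈ K, Continuous Φ) → (∀ Φ ∈ K, ∀ x, |Φ x| ≤ 1) →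
      ((fun _ => 1) ∈ K) → (∀ Φ ∈ K, ∀ Ψ ∈ K, (fun x => Φ x * Ψ x) ∈ K) →
      ∀ f : X → ℝ, Continuous f → (∀ x, |f x| ≤ 1) →
      ∃ s, BoundedComb K A s ∧ (∀ x, |s x| ≤ 2) ∧
        ∀ Ψ ∈ K, |haarIntegral fun x => (f x - s x) * Ψ x| ≤ ε := by
  -- If `|f - w| ≤ 6` and `η ≤ 1`, then an error `η` raises the square by at most `12 * η + η ^ 2 ≤
  -- 13 * η`.
  obtain ⟨η, hη, hη1, hη2⟩ : ∃ η : ℝ, 0 < η ∧ η ≤ 1 ∧ 13 * η ≤ ε ^ 2 / 2 :=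
    ⟨min 1 (ε ^ 2 / 26), by positivity, min_le_left _ _, by
      linarith [min_le_right (1 : ℝ) (ε ^ 2 / 26)]⟩
  obtain ⟨q, hq⟩ := exists_polynomial_near_clip hη 5
  -- Energy increment. If some `Ψ` has correlation `c` with `f - s`, passing to `s + c * Ψ` lowers
  -- the energy by at least `c ^ 2`. Clipping to `[-1, 1]` does not increase the distance to `f`,
  -- and a polynomial fixed in advance replaces clipping so that the result stays in the span of
  -- `K`.
  have key (n : ℕ) : ∃ A : ℝ, ∀ {X : Type u} [Group X] [TopologicalSpace X] [IsTopologicalGroup X]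
      [CompactSpace X] (K : Set (X → ℝ)), (∀ Φ ∈ K, Continuous Φ) → (∀ Φ ∈ K, ∀ x, |Φ x| ≤ 1) →
      ((fun _ => 1) ∈ K) → (∀ Φ ∈ K, ∀ Ψ ∈ K, (fun x => Φ x * Ψ x) ∈ K) →
      ∀ f : X → ℝ, Continuous f → (∀ x, |f x| ≤ 1) →
      (∃ s, BoundedComb K A s ∧ (∀ x, |s x| ≤ 2) ∧
        ∀ Ψ ∈ K, |haarIntegral fun x => (f x - s x) * Ψ x| ≤ ε) ∨
      ∃ s, BoundedComb K A s ∧ (∀ x, |s x| ≤ 2) ∧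
        haarIntegral (fun x => (f x - s x) ^ 2) ≤ 1 - n * (ε ^ 2 / 2) := by
    induction n with
    | zero =>
      refine ⟨0, fun K _ _ h1 _ f hf hf1 => Or.inr ⟨fun _ => 0, ?_, by simp, ?_⟩⟩
      · simpa using BoundedComb.const h1 0
      · refine (haarIntegral_le_of_le (c := 1) (by fun_prop) fun x => ?_).trans (by simp)
        rw [sub_zero, ← sq_abs]
        exact pow_le_one₀ (abs_nonneg _) (hf1 x)
    | succ n ih =>
      obtain ⟨A, hA⟩ := ih
      set Q : ℝ := ∑ i ∈ Finset.range (q.natDegree + 1), |q.coeff i| * (A + 3) ^ i with hQ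
      refine ⟨max A Q, fun {X} _ _ _ _ K hKc hK1 h1 hKm f hf hf1 => ?_⟩
      rcases hA K hKc hK1 h1 hKm f hf hf1 with ⟨s, hs, hs2, h⟩ | ⟨s, hs, hs2, h⟩
      · exact Or.inl ⟨s, hs.mono (le_max_left _ _), hs2, h⟩
      by_cases hgood : ∀ Ψ ∈ K, |haarIntegral fun x => (f x - s x) * Ψ x| ≤ ε
      · exact Or.inl ⟨s, hs.mono (le_max_left _ _), hs2, hgood⟩
      right
      push Not at hgood
      obtain ⟨Ψ, hΨ, hlt⟩ := hgood
      have hsc := hs.continuous hKc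
      have hΨc := hKc Ψ hΨ
      set c := haarIntegral fun x => (f x - s x) * Ψ x with hc
      have hc3 : |c| ≤ 3 := abs_haarIntegral_le_of_le (by fun_prop) fun x => by
        rw [abs_mul]
        calc |f x - s x| * |Ψ x| ≤ (|f x| + |s x|) * 1 :=
              mul_le_mul (abs_sub _ _) (hK1 Ψ hΨ x) (abs_nonneg _) (by positivity)
          _ ≤ 3 := by linarith [hf1 x, hs2 x]
      set w : X → ℝ := fun x => s x + c * Ψ x with hw
      have hwc : Continuous w := by fun_prop
      have hw5 (x : X) : |w x| ≤ 5 := by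
        have h1 : |c * Ψ x| ≤ 3 := by
          rw [abs_mul]
          exact (mul_le_of_le_one_right (abs_nonneg _) (hK1 Ψ hΨ x)).trans hc3
        exact (abs_add_le _ _).trans (by linarith [hs2 x])
      have hwcomb : BoundedComb K (A + 3) w := hs.add (.atom hΨ hc3)
      have hqc : Continuous fun x => q.eval (w x) := q.continuous.comp hwc
      refine ⟨fun x => q.eval (w x), (hwcomb.eval h1 hKm q).mono (le_max_right _ _),
        fun x => ?_, ?_⟩
      · have h2 := (abs_sub_abs_le_abs_sub _ _).trans (hq (w x) (hw5 x)).le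
        linarith [abs_clip_le_one (w x)]
      · have hpt (x : X) : (f x - q.eval (w x)) ^ 2 ≤ (f x - w x) ^ 2 + 13 * η := by
          have h2 : |f x - q.eval (w x)| ≤ |f x - w x| + η := by
            have h3 := abs_sub_le (f x) (max (-1) (min 1 (w x))) (q.eval (w x))
            have h4 := abs_sub_clip_le (hf1 x) (w x)
            have h5 := (hq (w x) (hw5 x)).le
            rw [abs_sub_comm] at h5
            linarith
          have h6 : |f x - w x| ≤ 6 := (abs_sub _ _).trans (by linarith [hf1 x, hw5 x])
          rw [← sq_abs, ← sq_abs (f x - w x)]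
          nlinarith [abs_nonneg (f x - q.eval (w x)), abs_nonneg (f x - w x)]
        have hexp : haarIntegral (fun x => (f x - w x) ^ 2) ≤
            haarIntegral (fun x => (f x - s x) ^ 2) - c ^ 2 := by
          have h2 : (fun x => (f x - w x) ^ 2) = fun x =>
              ((f x - s x) ^ 2 + (-(2 * c)) * ((f x - s x) * Ψ x)) + c ^ 2 * Ψ x ^ 2 := by
            funext x; simp only [hw]; ring
          have h3 : haarIntegral (fun x => Ψ x ^ 2) ≤ 1 :=
            haarIntegral_le_of_le (by fun_prop) fun x => by
              rw [← sq_abs]; exact pow_le_one₀ (abs_nonneg _) (hK1 Ψ hΨ x)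
          rw [h2, haarIntegral_add (by fun_prop) (by fun_prop),
            haarIntegral_add (by fun_prop) (by fun_prop), haarIntegral_const_mul,
            haarIntegral_const_mul, ← hc]
          nlinarith [sq_nonneg c]
        have hint := haarIntegral_mono (by fun_prop)
          (F' := fun x => (f x - w x) ^ 2 + 13 * η) (by fun_prop) hpt
        rw [haarIntegral_add (by fun_prop) (by fun_prop), haarIntegral_const] at hint
        have hc2 : ε ^ 2 ≤ c ^ 2 := by
          rw [← sq_abs c]; exact pow_le_pow_left₀ hε.le hlt.le 2
        push_cast
        linarith
  -- After this many increments the energy would be negative.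
  obtain ⟨n, hn⟩ := exists_nat_gt (1 / (ε ^ 2 / 2))
  rw [div_lt_iff₀ (by positivity)] at hn
  obtain ⟨A, hA⟩ := key n
  refine ⟨A, fun K hKc hK1 h1 hKm f hf hf1 => ?_⟩
  rcases hA K hKc hK1 h1 hKm f hf hf1 with h | ⟨s, -, -, h⟩
  · exact h
  · have h0 : 0 ≤ haarIntegral fun x => (f x - s x) ^ 2 := haarIntegral_nonneg fun x => sq_nonneg _
    linarith

/-! ### Mean absolute deviation -/

section Deviation

variable {G : Type*} [Group G] [TopologicalSpace G] [IsTopologicalGroup G] [CompactSpace G]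

/-- The mean absolute deviation of `c` from its average. -/
noncomputable def haarDeviation (c : G → ℝ) : ℝ :=
  haarIntegral fun g => |c g - haarIntegral c|

theorem haarDeviation_nonneg (c : G → ℝ) : 0 ≤ haarDeviation c :=
  haarIntegral_nonneg fun _ => abs_nonneg _

theorem haarDeviation_add_le {c d : G → ℝ} (hc : Continuous c) (hd : Continuous d) :
    haarDeviation (fun g => c g + d g) ≤ haarDeviation c + haarDeviation d := by
  unfold haarDeviation
  rw [haarIntegral_add hc hd]
  have h1 : Continuous fun g => |c g - haarIntegral c| := by fun_prop
  have h2 : Continuous fun g => |d g - haarIntegral d| := by fun_prop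
  rw [← haarIntegral_add h1 h2]
  refine haarIntegral_mono ((hc.add hd).sub continuous_const).abs (h1.add h2) fun g => ?_
  rw [add_sub_add_comm]
  exact abs_add_le _ _

theorem haarDeviation_const_mul (α : ℝ) (c : G → ℝ) :
    haarDeviation (fun g => α * c g) = |α| * haarDeviation c := by
  unfold haarDeviation
  simp only [haarIntegral_const_mul, ← mul_sub, abs_mul]

theorem haarDeviation_le {c : G → ℝ} (hc : Continuous c) :
    haarDeviation c ≤ 2 * haarIntegral fun g => |c g| := by
  have h := haarIntegral_mono (F := fun g => |c g - haarIntegral c|)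
    (F' := fun g => |c g| + |haarIntegral c|) (by fun_prop) (by fun_prop) fun g => abs_sub _ _
  rw [haarIntegral_add (by fun_prop) (by fun_prop), haarIntegral_const] at h
  have := abs_haarIntegral_le c
  unfold haarDeviation
  linarith

theorem haarDeviation_haarIntegral_le {X : Type*} [Group X] [TopologicalSpace X]
    [IsTopologicalGroup X] [CompactSpace X] {c : X → G → ℝ}
    (hc : Continuous fun p : X × G => c p.1 p.2) {δ : ℝ} (h : ∀ x, haarDeviation (c x) ≤ δ) :
    haarDeviation (fun g => haarIntegral fun x => c x g) ≤ δ := by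
  have hcx (x : X) : Continuous (c x) := hc.comp (by fun_prop : Continuous fun g : G => (x, g))
  have hcg (g : G) : Continuous fun x => c x g :=
    hc.comp (by fun_prop : Continuous fun x : X => (x, g))
  have hm : Continuous fun x => haarIntegral (c x) := Continuous.haarIntegral_left hc
  have hcs : Continuous fun p : G × X => c p.2 p.1 := hc.comp continuous_swap
  have hd : Continuous fun p : X × G => |c p.1 p.2 - haarIntegral (c p.1)| :=
    (hc.sub (hm.comp continuous_fst)).abs
  have hds : Continuous fun p : G × X => |c p.2 p.1 - haarIntegral (c p.2)| :=
    hd.comp continuous_swap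
  unfold haarDeviation
  calc haarIntegral (fun g => |(haarIntegral fun x => c x g) -
        haarIntegral fun h => haarIntegral fun x => c x h|)
      ≤ haarIntegral fun g => haarIntegral fun x => |c x g - haarIntegral (c x)| := by
        refine haarIntegral_mono (((Continuous.haarIntegral_left hcs).sub continuous_const).abs)
          (Continuous.haarIntegral_left hds) fun g => ?_
        rw [haarIntegral_swap hcs, ← haarIntegral_sub (hcg g) hm]
        exact abs_haarIntegral_le _
    _ = haarIntegral fun x => haarDeviation (c x) := haarIntegral_swap hds
    _ ≤ δ := haarIntegral_le_of_le (Continuous.haarIntegral_left hd) h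

end Deviation

/-! ### The prefix actions -/

section Prefix

variable {G : Type*} [Group G]

/-- The embedding of `G` in `G ^ k` as the diagonal of the coordinates up to `i`. -/
def prefixHom (k i : ℕ) : G →* (Fin k → G) where
  toFun u j := if (j : ℕ) ≤ i then u else 1
  map_one' := by funext j; simp
  map_mul' u v := by funext j; by_cases h : (j : ℕ) ≤ i <;> simp [h]

theorem prefixHom_apply (k i : ℕ) (u : G) (j : Fin k) :
    prefixHom k i u j = if (j : ℕ) ≤ i then u else 1 := rfl

theorem prefixHom_mul_prefixHom (k : ℕ) {i j : ℕ} (hij : i < j) (u v : G) :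
    prefixHom k j u * prefixHom k i v = prefixHom k i (u * v * u⁻¹) * prefixHom k j u := by
  funext l
  simp only [Pi.mul_apply, prefixHom_apply]
  by_cases h1 : (l : ℕ) ≤ i
  · simp [h1, h1.trans hij.le]
  · simp [h1]

theorem prefixAct_succ_eq_mul {k : ℕ} (i : Fin k) (g : G) (a : Fin k → G) :
    prefixAct i.succ g a = prefixHom k i g * a := by
  funext j
  simp only [prefixAct, Pi.mul_apply, prefixHom_apply, Fin.castSucc_lt_succ_iff, Fin.le_def]
  split_ifs <;> simp

/-- Every `prefixHom` moves the first coordinate; on the remaining ones the prefix is one shorter,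
so index `0` acts trivially there. This is what lowers `k` in the induction. -/
theorem prefixHom_mul_cons {k : ℕ} (i : Fin (k + 1)) (g x : G) (y : Fin k → G) :
    prefixHom (k + 1) i g * (Fin.cons x y : Fin (k + 1) → G) =
      Fin.cons (g * x) (prefixAct i g y) := by
  funext j
  refine Fin.cases ?_ (fun j => ?_) j
  · simp [prefixHom_apply]
  · simp only [Pi.mul_apply, prefixHom_apply, Fin.cons_succ, Fin.val_succ, prefixAct, Fin.lt_def,
      Fin.val_castSucc, Nat.succ_le_iff]
    split_ifs <;> simp

variable [TopologicalSpace G]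

theorem continuous_prefixHom (k i : ℕ) : Continuous (prefixHom k i : G →* (Fin k → G)) := by
  refine continuous_pi fun j => ?_
  simp only [prefixHom_apply]
  split_ifs <;> fun_prop

variable [IsTopologicalGroup G]

theorem continuous_prefixAct {k : ℕ} (i : Fin (k + 1)) :
    Continuous fun p : G × (Fin k → G) => prefixAct i p.1 p.2 := by
  refine continuous_pi fun j => ?_
  simp only [prefixAct]
  split_ifs <;> fun_prop

variable [CompactSpace G]

theorem continuous_multicorr {P : Type*} [TopologicalSpace P] {k : ℕ}
    {f : Fin (k + 1) → P → (Fin k → G) → ℝ}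
    (hf : ∀ i, Continuous fun q : P × (Fin k → G) => f i q.1 q.2) :
    Continuous fun q : P × G => multicorr (fun i => f i q.1) q.2 := by
  refine Continuous.haarIntegral_left ?_
  simp only [multicorrIntegrand]
  refine continuous_finsetProd _ fun i _ => ?_
  have : Continuous fun q : (P × G) × (Fin k → G) => prefixAct i q.1.2 q.2 :=
    (continuous_prefixAct i).comp (by fun_prop :
      Continuous fun q : (P × G) × (Fin k → G) => (q.1.2, q.2))
  exact (hf i).comp (by fun_prop :
    Continuous fun q : (P × G) × (Fin k → G) => (q.1.1, prefixAct i q.1.2 q.2))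

theorem continuous_multicorr_apply {k : ℕ} {f : Fin (k + 1) → (Fin k → G) → ℝ}
    (hf : ∀ i, Continuous (f i)) : Continuous (multicorr f) := by
  have h := continuous_multicorr (P := PUnit.{1}) (f := fun i _ => f i)
    fun i => (hf i).comp continuous_snd
  exact h.comp (by fun_prop : Continuous fun g : G => (PUnit.unit.{1}, g))

end Prefix

/-! ### Structured functions and correlations against them -/

section InvProducts

universe u

variable {G X : Type u} [Group G] [Group X] [TopologicalSpace X]
  {σ : ℕ → G →* X} {m : ℕ}

theorem continuous_of_mem_invProducts {Φ : X → ℝ} (h : Φ ∈ invProducts σ m) : Continuous Φ := by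
  obtain ⟨φ, hφ, -, -, rfl⟩ := h
  exact continuous_finsetProd _ fun i _ => hφ i

theorem abs_le_one_of_mem_invProducts {Φ : X → ℝ} (h : Φ ∈ invProducts σ m) (x : X) :
    |Φ x| ≤ 1 := by
  obtain ⟨φ, -, hφ, -, rfl⟩ := h
  exact abs_prod_le_one _ _ fun i _ => hφ i x

theorem one_mem_invProducts : (fun _ => 1) ∈ invProducts σ m :=
  ⟨fun _ _ => 1, fun _ => continuous_const, by simp, by simp, by simp⟩

theorem mul_mem_invProducts {Φ Ψ : X → ℝ} (hΦ : Φ ∈ invProducts σ m) (hΨ : Ψ ∈ invProducts σ m) :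
    (fun x => Φ x * Ψ x) ∈ invProducts σ m := by
  obtain ⟨φ, hφ, hφ1, hφσ, rfl⟩ := hΦ
  obtain ⟨ψ, hψ, hψ1, hψσ, rfl⟩ := hΨ
  exact ⟨fun i x => φ i x * ψ i x, fun i => (hφ i).mul (hψ i),
    fun i x => abs_mul_le_one (hφ1 i x) (hψ1 i x),
    fun i hi v x => by simp only [hφσ i hi, hψσ i hi], by simp only [Finset.prod_mul_distrib]⟩

variable [IsTopologicalGroup X]

theorem continuous_prod_action [TopologicalSpace G] (hσ : ∀ i, Continuous (σ i)) {f : ℕ → X → ℝ}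
    (hf : ∀ i, Continuous (f i)) :
    Continuous fun p : G × X => ∏ i ∈ Finset.range m, f i (σ i p.1 * p.2) := by
  refine continuous_finsetProd _ fun i _ => ?_
  have := hσ i
  have := hf i
  fun_prop

variable [CompactSpace X]

/-- The correlation of `F` with the translates of `f 0, …, f (m - 1)`. -/
noncomputable def actionCorr (σ : ℕ → G →* X) (m : ℕ) (f : ℕ → X → ℝ) (F : X → ℝ) (g : G) : ℝ :=
  haarIntegral fun x => F x * ∏ i ∈ Finset.range m, f i (σ i g * x)

theorem actionCorr_const_mul (f : ℕ → X → ℝ) (c : ℝ) (F : X → ℝ) :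
    actionCorr σ m f (fun x => c * F x) = fun g => c * actionCorr σ m f F g := by
  funext g
  simp only [actionCorr, mul_assoc, haarIntegral_const_mul]

variable [TopologicalSpace G]

theorem continuous_actionCorr (hσ : ∀ i, Continuous (σ i)) {f : ℕ → X → ℝ}
    (hf : ∀ i, Continuous (f i)) {F : X → ℝ} (hF : Continuous F) :
    Continuous (actionCorr σ m f F) :=
  Continuous.haarIntegral_left ((hF.comp continuous_snd).mul (continuous_prod_action hσ hf))

theorem actionCorr_add (hσ : ∀ i, Continuous (σ i)) {f : ℕ → X → ℝ}
    (hf : ∀ i, Continuous (f i)) {F F' : X → ℝ} (hF : Continuous F) (hF' : Continuous F') :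
    actionCorr σ m f (fun x => F x + F' x) =
      fun g => actionCorr σ m f F g + actionCorr σ m f F' g := by
  funext g
  have h : Continuous fun x => ∏ i ∈ Finset.range m, f i (σ i g * x) :=
    (continuous_prod_action hσ hf).comp (by fun_prop : Continuous fun x : X => (g, x))
  simp only [actionCorr, add_mul]
  exact haarIntegral_add (hF.mul h) (hF'.mul h)

variable [IsTopologicalGroup G] [CompactSpace G]

theorem BoundedComb.haarDeviation_actionCorr_le (hσ : ∀ i, Continuous (σ i)) {f : ℕ → X → ℝ}
    (hf : ∀ i, Continuous (f i)) {K : Set (X → ℝ)} (hK : ∀ Φ ∈ K, Continuous Φ) {δ : ℝ}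
    (hδ : ∀ Φ ∈ K, haarDeviation (actionCorr σ m f Φ) ≤ δ) {A : ℝ} {s : X → ℝ}
    (hs : BoundedComb K A s) : haarDeviation (actionCorr σ m f s) ≤ A * δ := by
  induction hs with
  | atom hΦ hc =>
    rw [actionCorr_const_mul, haarDeviation_const_mul]
    exact mul_le_mul hc (hδ _ hΦ) (haarDeviation_nonneg _) ((abs_nonneg _).trans hc)
  | add hs ht ih ih' =>
    have hsc := hs.continuous hK
    have htc := ht.continuous hK
    rw [actionCorr_add hσ hf hsc htc, add_mul]
    exact (haarDeviation_add_le (continuous_actionCorr hσ hf hsc)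
      (continuous_actionCorr hσ hf htc)).trans (add_le_add ih ih')

end InvProducts

/-! ### Multiple correlations of continuous functions -/

section ContinuousFunctions

universe u

theorem multicorr_eq_actionCorr {G : Type u} [Group G] [TopologicalSpace G] [IsTopologicalGroup G]
    [CompactSpace G] {m : ℕ} (f : Fin (m + 2) → (Fin (m + 1) → G) → ℝ) :
    multicorr f = actionCorr (prefixHom (m + 1)) (m + 1)
      (fun i => if h : i < m + 1 then f (Fin.succ ⟨i, h⟩) else fun _ => 1) (f 0) := by
  funext g
  unfold multicorr actionCorr
  congr 1; funext a
  rw [multicorrIntegrand, Fin.prod_univ_succ, prefixAct_zero, Finset.prod_range]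
  congr 1
  refine Finset.prod_congr rfl fun i _ => ?_
  simp only [prefixAct_succ_eq_mul, Fin.is_lt, dif_pos, Fin.eta]

/-- By invariance `φ i x` may be evaluated at the `i`-th translate of `x`. All factors then shift
the first coordinate by `g`, and left invariance in that coordinate absorbs the shift. -/
theorem actionCorr_eq_haarIntegral_multicorr {G : Type u} [Group G] [TopologicalSpace G]
    [IsTopologicalGroup G] [CompactSpace G] {m : ℕ} {φ f : ℕ → (Fin (m + 1) → G) → ℝ}
    (hφ : ∀ i, Continuous (φ i)) (hf : ∀ i, Continuous (f i))
    (hφσ : ∀ i < m + 1, ∀ v x, φ i (prefixHom (m + 1) i v * x) = φ i x) (g : G) :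
    actionCorr (prefixHom (m + 1)) (m + 1) f (fun x => ∏ i ∈ Finset.range (m + 1), φ i x) g =
      haarIntegral fun x : G => multicorr (fun (i : Fin (m + 1)) (y : Fin m → G) =>
        φ i (Fin.cons x y : Fin (m + 1) → G) * f i (Fin.cons x y : Fin (m + 1) → G)) g := by
  have h1 : actionCorr (prefixHom (m + 1)) (m + 1) f
      (fun x => ∏ i ∈ Finset.range (m + 1), φ i x) g =
      haarIntegral fun x : Fin (m + 1) → G => ∏ i : Fin (m + 1),
        (φ i (prefixHom (m + 1) i g * x) * f i (prefixHom (m + 1) i g * x)) := by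
    unfold actionCorr
    congr 1; funext x
    rw [← Finset.prod_mul_distrib, Finset.prod_range]
    refine Finset.prod_congr rfl fun i _ => ?_
    rw [hφσ i i.2]
  rw [h1, haarIntegral_fin_cons (by fun_prop)]
  simp only [prefixHom_mul_cons]
  rw [haarIntegral_mul_left fun x : G => haarIntegral fun y : Fin m → G => ∏ i : Fin (m + 1),
    (φ i (Fin.cons x (prefixAct i g y)) * f i (Fin.cons x (prefixAct i g y)))]
  rfl

theorem exists_haarDeviation_multicorr_le (k : ℕ) {η : ℝ} (hη : 0 < η) :
    ∃ D₀ : ℝ, ∀ D, D₀ ≤ D → ∀ (G : Type u) [Group G] [TopologicalSpace G] [IsTopologicalGroup G]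
      [CompactSpace G] [T2Space G], IsQuasirandom D G →
      ∀ f : Fin (k + 1) → (Fin k → G) → ℝ, (∀ i, Continuous (f i)) → (∀ i a, |f i a| ≤ 1) →
      haarDeviation (multicorr f) ≤ η := by
  induction k generalizing η with
  | zero =>
    refine ⟨0, fun D _ G _ _ _ _ _ _ f _ _ => ?_⟩
    have : multicorr f = fun _ => f 0 1 := by
      funext g
      unfold multicorr
      rw [haarIntegral_unique]
      simp [multicorrIntegrand, prefixAct_zero]
    rw [this]
    simp [haarDeviation, hη.le]
  | succ m ih =>
    -- The error bound below is `κ / 2 + 1 / D ≤ κ`. Extracting roots leaves a mean absolute value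
    -- of `η / 12`; the factors `3` (rescaling of `E`) and `2` (`haarDeviation_le`) bring it to `η /
    -- 2`.
    set κ : ℝ := ((η / 12) ^ 2) ^ 2 ^ (m + 1) with hκ
    have hκ0 : 0 < κ := by positivity
    obtain ⟨A, hA⟩ := exists_boundedComb_near.{u} (half_pos hκ0)
    -- Since `A` is fixed before `G` and `D`, the inductive accuracy may depend on it.
    obtain ⟨D₁, hD₁⟩ := ih (η := η / (2 * (|A| + 1))) (by positivity)
    refine ⟨max D₁ (2 / κ), fun D hD G _ _ _ _ _ hG f hf hf1 => ?_⟩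
    have hD2 : 2 / κ ≤ D := (le_max_right _ _).trans hD
    have hD0 : 0 < D := lt_of_lt_of_le (by positivity) hD2
    have hDκ : 1 / D ≤ κ / 2 := by
      rw [div_le_iff₀ hκ0] at hD2
      rw [div_le_iff₀ hD0]
      linarith
    set σ : ℕ → G →* (Fin (m + 1) → G) := prefixHom (m + 1) with hσ_def
    have hσ (i : ℕ) : Continuous (σ i) := continuous_prefixHom (m + 1) i
    set f' : ℕ → (Fin (m + 1) → G) → ℝ :=
      fun i => if h : i < m + 1 then f (Fin.succ ⟨i, h⟩) else fun _ => 1 with hf'_def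
    have hf' (i : ℕ) : Continuous (f' i) := by
      simp only [hf'_def]
      split_ifs
      exacts [hf _, continuous_const]
    have hf'1 (i : ℕ) (x) : |f' i x| ≤ 1 := by
      simp only [hf'_def]
      split_ifs
      exacts [hf1 _ _, by simp]
    rw [multicorr_eq_actionCorr f]
    set K := invProducts σ (m + 1) with hK
    have hKc : ∀ Φ ∈ K, Continuous Φ := fun Φ => continuous_of_mem_invProducts
    obtain ⟨s, hs, hs2, hE⟩ := hA K hKc (fun Φ => abs_le_one_of_mem_invProducts)
      one_mem_invProducts (fun Φ hΦ Ψ hΨ => mul_mem_invProducts hΦ hΨ) (f 0) (hf 0) (hf1 0)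
    have hsc := hs.continuous hKc
    have hstruct : haarDeviation (actionCorr σ (m + 1) f' s) ≤
        A * (η / (2 * (|A| + 1))) := by
      refine hs.haarDeviation_actionCorr_le hσ hf' hKc ?_
      rintro Φ ⟨φ, hφ, hφ1, hφσ, rfl⟩
      have h1 : actionCorr σ (m + 1) f' (fun x => ∏ i ∈ Finset.range (m + 1), φ i x) = fun g =>
          haarIntegral fun x : G => multicorr (fun (i : Fin (m + 1)) (y : Fin m → G) =>
            φ i (Fin.cons x y : Fin (m + 1) → G) * f' i (Fin.cons x y : Fin (m + 1) → G)) g :=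
        funext fun g => actionCorr_eq_haarIntegral_multicorr hφ hf' hφσ g
      rw [h1]
      have hcons : Continuous fun q : G × (Fin m → G) => (Fin.cons q.1 q.2 : Fin (m + 1) → G) :=
        Continuous.finCons (A := fun _ => G) continuous_fst continuous_snd
      refine haarDeviation_haarIntegral_le (continuous_multicorr
        (f := fun (i : Fin (m + 1)) (x : G) (y : Fin m → G) =>
          φ i (Fin.cons x y : Fin (m + 1) → G) * f' i (Fin.cons x y : Fin (m + 1) → G))
        fun i => ((hφ i).comp hcons).mul ((hf' i).comp hcons)) fun x => ?_
      refine hD₁ D ((le_max_left _ _).trans hD) G hG _ (fun i => ?_)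
        fun i y => abs_mul_le_one (hφ1 _ _) (hf'1 _ _)
      have hcx : Continuous fun y : Fin m → G => (Fin.cons x y : Fin (m + 1) → G) :=
        hcons.comp (by fun_prop : Continuous fun y : Fin m → G => (x, y))
      exact ((hφ i).comp hcx).mul ((hf' i).comp hcx)
    have hA1 : A * (η / (2 * (|A| + 1))) ≤ η / 2 := by
      rw [mul_div_assoc', div_le_div_iff₀ (by positivity) (by positivity)]
      nlinarith [le_abs_self A]
    set E : (Fin (m + 1) → G) → ℝ := fun x => (1 / 3) * (f 0 x - s x) with hE_def
    have hf0 := hf 0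
    have hEc : Continuous E := by fun_prop
    have hE1 (x) : |E x| ≤ 1 := by
      have := abs_sub (f 0 x) (s x)
      rw [hE_def, abs_mul, abs_of_nonneg (by norm_num : (0 : ℝ) ≤ 1 / 3)]
      linarith [hf1 0 x, hs2 x]
    have hEK : ∀ Φ ∈ invProducts σ (m + 1), |haarIntegral fun x => E x * Φ x| ≤ κ / 2 := by
      intro Φ hΦ
      simp only [hE_def, mul_assoc, haarIntegral_const_mul, abs_mul]
      rw [abs_of_nonneg (by norm_num : (0 : ℝ) ≤ 1 / 3)]
      linarith [hE Φ hΦ, abs_nonneg (haarIntegral fun x => (f 0 x - s x) * Φ x)]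
    have hsq := pow_haarIntegral_sq_correlation_le hD0 hG hσ
      (fun i j hij u v => prefixHom_mul_prefixHom (m + 1) hij u v)
      -- The `i`-th coordinate is translated by `σ i` and untouched by `σ j` for `j < i`.
      (π := fun i x => if h : i < m + 1 then x ⟨i, h⟩ else 1)
      (fun i => by split_ifs <;> fun_prop)
      (fun i hi v x => by simp [hi, hσ_def, prefixHom_apply])
      (fun i j hij hj v x => by simp [hj, hσ_def, prefixHom_apply, hij])
      hEc hE1 hEK hf' hf'1
    have hcE : Continuous (actionCorr σ (m + 1) f' E) := continuous_actionCorr hσ hf' hEc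
    have hsq2 : haarIntegral (fun g => actionCorr σ (m + 1) f' E g ^ 2) ≤ (η / 12) ^ 2 := by
      refine le_of_pow_le_pow_left₀ (pow_ne_zero (m + 1) two_ne_zero) (sq_nonneg _) ?_
      exact hsq.trans (by linarith)
    have habs : haarIntegral (fun g => |actionCorr σ (m + 1) f' E g|) ≤ η / 12 := by
      refine le_of_sq_le_sq ?_ (by positivity)
      refine (sq_haarIntegral_le hcE.abs).trans ?_
      simpa only [sq_abs] using hsq2
    have hsplit : f 0 = fun x => s x + 3 * E x := by
      funext x; simp only [hE_def]; ring
    rw [hsplit, actionCorr_add hσ hf' hsc (by fun_prop), actionCorr_const_mul]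
    refine (haarDeviation_add_le (continuous_actionCorr hσ hf' hsc) (by fun_prop)).trans ?_
    rw [haarDeviation_const_mul, abs_of_nonneg (by norm_num : (0 : ℝ) ≤ 3)]
    have := haarDeviation_le hcE
    linarith

end ContinuousFunctions

/-! ### Approximation of measurable functions by continuous ones -/

section Measurable

variable {H : Type*} [Group H] [TopologicalSpace H] [IsTopologicalGroup H] [CompactSpace H]

theorem HaarMeasurable.haarIntegrable {F : H → ℝ} (hF : HaarMeasurable F) (hF1 : ∀ x, |F x| ≤ 1) :
    HaarIntegrable F := by
  borelize H
  rw [haarIntegrable_iff_integrable]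
  exact Integrable.of_bound (C := 1) hF (ae_of_all _ hF1)

theorem HaarMeasurable.comp_mul_left {F : H → ℝ} (hF : HaarMeasurable F) (h : H) :
    HaarMeasurable fun x => F (h * x) := by
  borelize H
  exact AEStronglyMeasurable.comp_measurePreserving hF
    (measurePreserving_mul_left (Measure.haarMeasure ⊤) h)

theorem Continuous.haarMeasurable {F : H → ℝ} (hF : Continuous F) : HaarMeasurable F := by
  borelize H
  exact hF.aestronglyMeasurable

theorem HaarMeasurable.finsetProd {ι : Type*} (s : Finset ι) {F : ι → H → ℝ}
    (hF : ∀ i, HaarMeasurable (F i)) : HaarMeasurable fun x => ∏ i ∈ s, F i x := by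
  borelize H
  exact Finset.aestronglyMeasurable_fun_prod s fun i _ => hF i

theorem HaarMeasurable.exists_continuous_near [T2Space H] {F : H → ℝ} (hF : HaarMeasurable F)
    (hF1 : ∀ x, |F x| ≤ 1) {ε : ℝ} (hε : 0 < ε) :
    ∃ F' : H → ℝ, Continuous F' ∧ (∀ x, |F' x| ≤ 1) ∧
      haarIntegral (fun x => |F x - F' x|) ≤ ε := by
  borelize H
  have hFi := (haarIntegrable_iff_integrable F).1 (hF.haarIntegrable hF1)
  obtain ⟨F', -, hle, hc, hi⟩ := hFi.exists_hasCompactSupport_integral_sub_le hε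
  refine ⟨fun x => max (-1) (min 1 (F' x)), by fun_prop, fun x => abs_clip_le_one _, ?_⟩
  rw [haarIntegral_eq_integral]
  refine le_trans (integral_mono ?_ (hFi.sub hi).norm fun x => abs_sub_clip_le (hF1 x) _) hle
  exact (hFi.sub (Continuous.integrable_of_compactSpace (by fun_prop))).norm

end Measurable

/-! ### Passage from continuous to measurable functions -/

theorem abs_prod_sub_prod_le {ι : Type*} (s : Finset ι) {a b : ι → ℝ} (ha : ∀ i, |a i| ≤ 1)
    (hb : ∀ i, |b i| ≤ 1) : |∏ i ∈ s, a i - ∏ i ∈ s, b i| ≤ ∑ i ∈ s, |a i - b i| := by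
  classical
  induction s using Finset.induction_on with
  | empty => simp
  | insert i s hi ih =>
    rw [Finset.prod_insert hi, Finset.prod_insert hi, Finset.sum_insert hi]
    have h : a i * ∏ j ∈ s, a j - b i * ∏ j ∈ s, b j =
        (a i - b i) * ∏ j ∈ s, a j + b i * (∏ j ∈ s, a j - ∏ j ∈ s, b j) := by ring
    rw [h]
    refine (abs_add_le _ _).trans (add_le_add ?_ ?_)
    · rw [abs_mul]
      exact mul_le_of_le_one_right (abs_nonneg _) (abs_prod_le_one s a fun j _ => ha j)
    · rw [abs_mul]
      exact (mul_le_of_le_one_left (abs_nonneg _) (hb i)).trans ih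

section Multicorr

theorem exists_prefixAct_eq_mul {G : Type*} [Group G] {k : ℕ} (i : Fin (k + 1)) (g : G) :
    ∃ p : Fin k → G, ∀ a, prefixAct i g a = p * a := by
  refine ⟨fun j => if j.castSucc < i then g else 1, fun a => ?_⟩
  funext j
  simp only [prefixAct, Pi.mul_apply]
  split_ifs <;> simp

variable {G : Type*} [Group G] [TopologicalSpace G] [IsTopologicalGroup G] [CompactSpace G] {k : ℕ}

theorem HaarMeasurable.comp_prefixAct {F : (Fin k → G) → ℝ} (hF : HaarMeasurable F)
    (i : Fin (k + 1)) (g : G) : HaarMeasurable fun a => F (prefixAct i g a) := by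
  obtain ⟨p, hp⟩ := exists_prefixAct_eq_mul (k := k) i g
  simp only [hp]
  exact hF.comp_mul_left p

theorem haarIntegral_comp_prefixAct (F : (Fin k → G) → ℝ) (i : Fin (k + 1)) (g : G) :
    haarIntegral (fun a => F (prefixAct i g a)) = haarIntegral F := by
  obtain ⟨p, hp⟩ := exists_prefixAct_eq_mul (k := k) i g
  simp only [hp]
  exact haarIntegral_mul_left F p

theorem haarIntegrable_multicorrIntegrand {f : Fin (k + 1) → (Fin k → G) → ℝ}
    (hf : ∀ i, HaarMeasurable (f i)) (hf1 : ∀ i a, |f i a| ≤ 1) (g : G) :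
    HaarIntegrable (multicorrIntegrand f g) :=
  (HaarMeasurable.finsetProd _ fun i => (hf i).comp_prefixAct i g).haarIntegrable
    fun _ => abs_prod_le_one _ _ fun i _ => hf1 i _

/-- Telescope the product; the prefix actions preserve Haar measure, so the bound is uniform in `g`.
-/
theorem abs_multicorr_sub_multicorr_le {f f' : Fin (k + 1) → (Fin k → G) → ℝ}
    (hf : ∀ i, HaarMeasurable (f i)) (hf1 : ∀ i a, |f i a| ≤ 1)
    (hf' : ∀ i, HaarMeasurable (f' i)) (hf'1 : ∀ i a, |f' i a| ≤ 1) (g : G) :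
    |multicorr f g - multicorr f' g| ≤ ∑ i, haarIntegral fun a => |f i a - f' i a| := by
  have hsub (i : Fin (k + 1)) : HaarIntegrable fun a =>
      |f i (prefixAct i g a) - f' i (prefixAct i g a)| := by
    borelize (Fin k → G)
    have h1 := ((hf i).comp_prefixAct i g).haarIntegrable fun a => hf1 i _
    have h2 := ((hf' i).comp_prefixAct i g).haarIntegrable fun a => hf'1 i _
    rw [haarIntegrable_iff_integrable] at h1 h2 ⊢
    exact (h1.sub h2).abs
  have h1 := haarIntegrable_multicorrIntegrand hf hf1 g
  have h2 := haarIntegrable_multicorrIntegrand hf' hf'1 g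
  have h3 (i : Fin (k + 1)) := haarIntegral_comp_prefixAct (fun a => |f i a - f' i a|) i g
  simp only [← h3]
  unfold multicorr
  borelize (Fin k → G)
  simp only [haarIntegrable_iff_integrable] at hsub h1 h2
  simp only [haarIntegral_eq_integral]
  rw [← integral_sub h1 h2, ← integral_finsetSum _ fun i _ => hsub i]
  refine abs_integral_le_integral_abs.trans (integral_mono (h1.sub h2).abs
    (integrable_finsetSum _ fun i _ => hsub i) fun a => ?_)
  exact abs_prod_sub_prod_le _ (fun i => hf1 i _) fun i => hf'1 i _

/-- Multiple correlation sequences are uniform limits of those of continuous functions. -/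
theorem exists_continuous_multicorr_near [T2Space G] {f : Fin (k + 1) → (Fin k → G) → ℝ}
    (hf : ∀ i, HaarMeasurable (f i)) (hf1 : ∀ i a, |f i a| ≤ 1) {ε : ℝ} (hε : 0 < ε) :
    ∃ f' : Fin (k + 1) → (Fin k → G) → ℝ, (∀ i, Continuous (f' i)) ∧ (∀ i a, |f' i a| ≤ 1) ∧
      ∀ g, |multicorr f g - multicorr f' g| ≤ ε := by
  have hε' : 0 < ε / (k + 1) := by positivity
  choose f' hc hb hle using fun i => (hf i).exists_continuous_near (hf1 i) hε'
  refine ⟨f', hc, hb, fun g => ?_⟩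
  refine (abs_multicorr_sub_multicorr_le hf hf1 (fun i => (hc i).haarMeasurable) hb g).trans ?_
  refine (Finset.sum_le_sum fun i _ => hle i).trans (le_of_eq ?_)
  simp only [Finset.sum_const, Finset.card_univ, Fintype.card_fin, nsmul_eq_mul]
  push_cast
  field_simp

/-- A uniform limit of continuous sequences; joint measurability in `g` and `a` never enters. -/
theorem continuous_multicorr_of_haarMeasurable [T2Space G] {f : Fin (k + 1) → (Fin k → G) → ℝ}
    (hf : ∀ i, HaarMeasurable (f i)) (hf1 : ∀ i a, |f i a| ≤ 1) : Continuous (multicorr f) := by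
  refine continuous_of_uniform_approx_of_continuous fun u hu => ?_
  obtain ⟨ε, hε, hεu⟩ := Metric.mem_uniformity_dist.1 hu
  obtain ⟨f', hc, -, hle⟩ := exists_continuous_multicorr_near hf hf1 (half_pos hε)
  refine ⟨multicorr f', continuous_multicorr_apply hc, fun g => hεu ?_⟩
  rw [Real.dist_eq]
  linarith [hle g]

end Multicorr

/-- The deviation bound for continuous functions extends to measurable functions. -/
theorem haarDeviation_multicorr_le_of_continuous {G : Type*} [Group G] [TopologicalSpace G]
    [IsTopologicalGroup G] [CompactSpace G] [T2Space G] {k : ℕ} {η : ℝ}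
    (h : ∀ f : Fin (k + 1) → (Fin k → G) → ℝ, (∀ i, Continuous (f i)) → (∀ i a, |f i a| ≤ 1) →
      haarDeviation (multicorr f) ≤ η) {f : Fin (k + 1) → (Fin k → G) → ℝ}
    (hf : ∀ i, HaarMeasurable (f i)) (hf1 : ∀ i a, |f i a| ≤ 1) :
    haarDeviation (multicorr f) ≤ η := by
  refine le_of_forall_pos_le_add fun ε hε => ?_
  obtain ⟨f', hc, hb, hle⟩ := exists_continuous_multicorr_near hf hf1 (half_pos hε)
  have hc1 := continuous_multicorr_of_haarMeasurable hf hf1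
  have hc2 := continuous_multicorr_apply hc
  have hsplit : multicorr f = fun g => multicorr f' g + (multicorr f g - multicorr f' g) := by
    funext g; ring
  rw [hsplit]
  refine (haarDeviation_add_le hc2 (hc1.sub hc2)).trans (add_le_add (h f' hc hb) ?_)
  refine (haarDeviation_le (hc1.sub hc2)).trans ?_
  have := haarIntegral_le_of_le (hc1.sub hc2).abs hle
  linarith

theorem exists_haarDeviation_multicorr_le_of_haarMeasurable.{u} (k : ℕ) {η : ℝ} (hη : 0 < η) :
    ∃ D₀ : ℝ, ∀ D, D₀ ≤ D → ∀ (G : Type u) [Group G] [TopologicalSpace G] [IsTopologicalGroup G]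
      [CompactSpace G] [T2Space G], IsQuasirandom D G →
      ∀ f : Fin (k + 1) → (Fin k → G) → ℝ, (∀ i, HaarMeasurable (f i)) →
      (∀ i a, |f i a| ≤ 1) → haarDeviation (multicorr f) ≤ η := by
  obtain ⟨D₀, h⟩ := exists_haarDeviation_multicorr_le.{u} k hη
  exact ⟨D₀, fun D hD G _ _ _ _ _ hG f hf hf1 =>
    haarDeviation_multicorr_le_of_continuous (h D hD G hG) hf hf1⟩

theorem haarDeviation_multicorr_le_two {G : Type*} [Group G] [TopologicalSpace G]
    [IsTopologicalGroup G] [CompactSpace G] [T2Space G] {k : ℕ}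
    {f : Fin (k + 1) → (Fin k → G) → ℝ} (hf : ∀ i, HaarMeasurable (f i))
    (hf1 : ∀ i a, |f i a| ≤ 1) : haarDeviation (multicorr f) ≤ 2 := by
  refine haarDeviation_multicorr_le_of_continuous (fun f hf hf1 => ?_) hf hf1
  have hc := continuous_multicorr_apply hf
  refine (haarDeviation_le hc).trans ?_
  have := haarIntegral_le_of_le hc.abs (c := 1) fun g => by
    refine (abs_haarIntegral_le _).trans ?_
    borelize (Fin k → G)
    have h := (haarIntegrable_iff_integrable _).1
      (haarIntegrable_multicorrIntegrand (fun i => (hf i).haarMeasurable) hf1 g)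
    rw [haarIntegral_eq_integral]
    have h2 := integral_mono h.abs (integrable_const (1 : ℝ)) fun a =>
      abs_prod_le_one Finset.univ (fun i => f i (prefixAct i g a)) fun i _ => hf1 i _
    simpa using h2
  linarith

theorem theorem3 (k : ℕ) :
    ∃ δ : ℝ → ℝ, Tendsto δ atTop (𝓝 0) ∧
      ∀ (D : ℝ) (G : Type*) [Group G] [TopologicalSpace G] [IsTopologicalGroup G]
        [CompactSpace G] [T2Space G],
        IsQuasirandom D G →
        ∀ f : Fin (k + 1) → (Fin k → G) → ℝ,
          (∀ i, HaarMeasurable (f i)) →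
          (∀ i a, f i a ∈ Set.Icc (-1 : ℝ) 1) →
          (∀ g, HaarIntegrable (multicorrIntegrand f g)) ∧
          HaarIntegrable (multicorr f) ∧
          haarIntegral (fun g => |multicorr f g - haarIntegral (multicorr f)|) ≤ δ D := by
  -- All bounds valid for every `D`-quasirandom group; `δ D` is their infimum. The trivial bound `2`
  -- keeps the set nonempty for every real `D`.
  let S : ℝ → Set ℝ := fun D => {η | 0 ≤ η ∧
    ∀ (G : Type _) [Group G] [TopologicalSpace G] [IsTopologicalGroup G] [CompactSpace G]
      [T2Space G], IsQuasirandom D G → ∀ f : Fin (k + 1) → (Fin k → G) → ℝ,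
      (∀ i, HaarMeasurable (f i)) → (∀ i a, |f i a| ≤ 1) → haarDeviation (multicorr f) ≤ η}
  have hbdd (D : ℝ) : BddBelow (S D) := ⟨0, fun η hη => hη.1⟩
  have hne (D : ℝ) : (S D).Nonempty :=
    ⟨2, by norm_num, fun G _ _ _ _ _ _ f hf hf1 => haarDeviation_multicorr_le_two hf hf1⟩
  refine ⟨fun D => sInf (S D), ?_, fun D G _ _ _ _ _ hG f hf hf1 => ?_⟩
  · refine Metric.tendsto_atTop.2 fun ε hε => ?_
    obtain ⟨D₀, hD₀⟩ := exists_haarDeviation_multicorr_le_of_haarMeasurable k (half_pos hε)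
    refine ⟨D₀, fun D hD => ?_⟩
    have h1 : sInf (S D) ≤ ε / 2 := csInf_le (hbdd D) ⟨(half_pos hε).le, hD₀ D hD⟩
    have h2 : 0 ≤ sInf (S D) := le_csInf (hne D) fun η hη => hη.1
    rw [Real.dist_eq, sub_zero, abs_of_nonneg h2]
    linarith
  · have hf1' (i a) : |f i a| ≤ 1 := abs_le.2 (hf1 i a)
    exact ⟨haarIntegrable_multicorrIntegrand hf hf1',
      (continuous_multicorr_of_haarMeasurable hf hf1').haarIntegrable,
      le_csInf (hne D) fun η hη => hη.2 G hG f hf hf1'⟩
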